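/- All Banach spaces are real. Let $(\mathcal M,d)$ be a metric space with a distinguished point $0$. Let $\mathrm{Lip}_0(\mathcal M)$ be the Banach space of Lipschitz functions $f:\mathcal M\to\mathbb R$ with $f(0)=0$, normed by the least Lipschitz constant, let $\delta(m)\in \mathrm{Lip}_0(\mathcal M)^*$ be the evaluation at $m\in\mathcal M$, and let $\mathcal F(\mathcal M)=\overline{\mathrm{span}}\{\delta(m):m\in\mathcal M\}\subset \mathrm{Lip}_0(\mathcal M)^*$ be the Lipschitz-free space. We identify $\mathcal F(\mathcal M)^*$ with $\mathrm{Lip}_0(\mathcal M)$ through the evaluation pairing. For a Hausdorff topological group $G$ let $C^b_{lu}(G)$ (resp. $C^b_{ru}(G)$) be the space of bounded $f:G\to\mathbb R$ for which $x\mapsto f(x\,\cdot)$ (resp. $x\mapsto f(\cdot\, x)$) is continuous from $G$ to $(\ell_\infty(G),\|\cdot\|_\infty)$, and let $C^b_u(G)=C^b_{lu}(G)\cap C^b_{ru}(G)$. A mean on a space of functions containing $1$ is a positive linear functional taking the value $1$ at $1$; it is left-invariant (resp. bi-invariant) if it is invariant under left (resp. left and right) translations. $G$ is amenable if $C^b_{lu}(G)$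 has a left-invariant mean, and SIN if every neighbourhood $U$ of $e$ contains a neighbourhood $V$ of $e$ with $gVg^{-1}=V$ for all $g\in G$. Let $G$ be an amenable Hausdorff topological group that is locally compact or SIN, acting continuously by isometries on $\mathcal M$ with bounded orbits. Let $T_g:\mathcal F(\mathcal M)\to\mathcal F(\mathcal M)$ be the linear isometry with $T_g\delta(m)=\delta(gm)-\delta(g0)$. Put $I_G=\{x\in\mathcal F(\mathcal M): T_gx=x\ \forall g\in G\}$ and $\mathrm{Lip}_0^G(\mathcal M)=\{f\in\mathrm{Lip}_0(\mathcal M): f(gx)=f(x)\ \forall g\in G,\ x\in\mathcal M\}$. Let $\mathcal M/G$ be the set of closures of orbits with the Hausdorff metric, with distinguished point $\overline{G0}$. Let $D=L_\infty(G)$ (for a Haar measure) if $G$ is locally compact, or $D=C^b_u(G)$ if $G$ is SIN (either choice is allowed if $G$ is both). Then there is a bi-invariant mean on $D$, and for every bi-invariant mean $M$ on $D$ the formula $$R_G(x)(x^*)=M\big(g\mapsto x^*(T_gx)\big),\qquad x\in \mathcal F(\mathcal M),\ x^*\in\mathcal F(\mathcal M)^*,$$ gives a well-defined linear operator $R_G:\mathcal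 F(\mathcal M)\to\mathcal F(\mathcal M)^{**}$ with $\|R_G\|\le1$ such that: - the range of $R_G$ is closed in $\mathcal F(\mathcal M)^{**}$ and linearly isometric to $\mathcal F(\mathcal M/G)$; - the operator $\widetilde{P_G}=(R_G)^*\circ\kappa$ on $\mathcal F(\mathcal M)^*=\mathrm{Lip}_0(\mathcal M)$, with $\kappa$ the canonical embedding of $\mathcal F(\mathcal M)^*$ into its bidual, is a projection with range $\mathrm{Lip}_0^G(\mathcal M)$; - $\ker R_G=\overline{\mathrm{span}}\{\delta(gx)-\delta(x): x\in\mathcal M,\ g\in G\}$. In particular: 1. $\mathrm{Lip}_0(\mathcal M/G)$ is linearly isometric to a subspace of $\mathrm{Lip}_0(\mathcal M)$ that is the range of a linear projection of norm at most $1$; 2. if $\mathrm{Lip}_0^G(\mathcal M)\cap (I_G)^\perp=\{0\}$, where $(I_G)^\perp\subset\mathcal F(\mathcal M)^*=\mathrm{Lip}_0(\mathcal M)$ is the annihilator of $I_G$, then $I_G$ is the range of a linear projection on $\mathcal F(\mathcal M)$ of norm at most $1$. -/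

import Mathlib

set_option maxSynthPendingDepth 3

open Topology MeasureTheory
open scoped ENNReal NNReal

noncomputable section

namespace LipFree

universe u v

/-! ### The space of Lipschitz functions vanishing at the base point -/

section Lip

variable {M : Type v} [MetricSpace M]

/-- Real Lipschitz functions on `M` vanishing at the base point `o`, as a vector space. -/
def lipSubmodule (o : M) : Submodule ℝ (M → ℝ) where
  carrier := {f | f o = 0 ∧ ∃ C : ℝ, 0 ≤ C ∧ ∀ x y, |f x - f y| ≤ C * dist x y}
  zero_mem' := ⟨rfl, 0, le_rfl, by simp⟩
  add_mem' := by
    rintro f g ⟨hf, C, hC, hfC⟩ ⟨hg, D, hD, hgD⟩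
    refine ⟨by simp [hf, hg], C + D, add_nonneg hC hD, fun x y => ?_⟩
    have h : (f + g) x - (f + g) y = (f x - f y) + (g x - g y) := by
      simp only [Pi.add_apply]; ring
    rw [h, add_mul]
    exact (abs_add_le _ _).trans (add_le_add (hfC x y) (hgD x y))
  smul_mem' := by
    rintro c f ⟨hf, C, hC, hfC⟩
    refine ⟨by simp [hf], |c| * C, mul_nonneg (abs_nonneg _) hC, fun x y => ?_⟩
    have h : (c • f) x - (c • f) y = c * (f x - f y) := by
      simp only [Pi.smul_apply, smul_eq_mul]; ring
    rw [h, abs_mul, mul_assoc]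
    exact mul_le_mul_of_nonneg_left (hfC x y) (abs_nonneg _)

variable {o : M}

/-- The least Lipschitz constant of `f`. -/
def lipNorm (f : lipSubmodule o) : ℝ :=
  sInf {C : ℝ | 0 ≤ C ∧ ∀ x y, |f.1 x - f.1 y| ≤ C * dist x y}

theorem lipNorm_le (f : lipSubmodule o) {C : ℝ} (hC : 0 ≤ C)
    (h : ∀ x y, |f.1 x - f.1 y| ≤ C * dist x y) : lipNorm f ≤ C :=
  csInf_le ⟨0, fun _ h => h.1⟩ ⟨hC, h⟩

theorem lipNorm_nonneg (f : lipSubmodule o) : 0 ≤ lipNorm f := Real.sInf_nonneg fun _ h => h.1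

theorem le_lipNorm (f : lipSubmodule o) (x y : M) :
    |f.1 x - f.1 y| ≤ lipNorm f * dist x y := by
  rcases (dist_nonneg (x := x) (y := y)).eq_or_lt with h | h
  · have : x = y := dist_eq_zero.1 h.symm
    simp [this]
  · rw [← div_le_iff₀ h]
    exact le_csInf f.2.2 fun C hC => (div_le_iff₀ h).2 (hC.2 x y)

theorem lipNorm_smul_le (c : ℝ) (f : lipSubmodule o) : lipNorm (c • f) ≤ |c| * lipNorm f :=
  lipNorm_le _ (mul_nonneg (abs_nonneg _) (lipNorm_nonneg f)) fun x y => by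
    have h : (c • f).1 x - (c • f).1 y = c * (f.1 x - f.1 y) := (mul_sub _ _ _).symm
    rw [h, abs_mul, mul_assoc]
    exact mul_le_mul_of_nonneg_left (le_lipNorm f x y) (abs_nonneg _)

/-- The norm of a Lipschitz function is its least Lipschitz constant. -/
abbrev lipNormInst (o : M) : Norm (lipSubmodule o) := ⟨lipNorm⟩

theorem lipNormCore (o : M) :
    @NormedSpace.Core ℝ (lipSubmodule o) _ _ _ (lipNormInst o) :=
  let _ := lipNormInst o
  { norm_nonneg := lipNorm_nonneg
    norm_smul := fun c f => by
      change lipNorm (c • f) = ‖c‖ * lipNorm f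
      rw [Real.norm_eq_abs]
      refine le_antisymm (lipNorm_smul_le c f) ?_
      rcases eq_or_ne c 0 with rfl | hc
      · simpa using lipNorm_nonneg _
      · have h := lipNorm_smul_le c⁻¹ (c • f)
        rw [smul_smul, inv_mul_cancel₀ hc, one_smul, abs_inv] at h
        calc |c| * lipNorm f ≤ |c| * (|c|⁻¹ * lipNorm (c • f)) :=
              mul_le_mul_of_nonneg_left h (abs_nonneg _)
          _ = lipNorm (c • f) := by rw [mul_inv_cancel_left₀ (abs_ne_zero.2 hc)]
    norm_triangle := fun f g =>
      lipNorm_le _ (add_nonneg (lipNorm_nonneg f) (lipNorm_nonneg g)) fun x y => by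
        have h : (f + g).1 x - (f + g).1 y = (f.1 x - f.1 y) + (g.1 x - g.1 y) :=
          add_sub_add_comm _ _ _ _
        rw [h, add_mul]
        exact (abs_add_le _ _).trans (add_le_add (le_lipNorm f x y) (le_lipNorm g x y))
    norm_eq_zero_iff := fun f => by
      constructor
      · intro h
        refine Subtype.ext (funext fun x => ?_)
        have h1 := le_lipNorm f x o
        have h2 : lipNorm f = 0 := h
        rw [h2, zero_mul, f.2.1, sub_zero] at h1
        exact abs_eq_zero.1 (le_antisymm h1 (abs_nonneg _))
      · rintro rfl
        exact le_antisymm (lipNorm_le _ le_rfl (by simp)) (lipNorm_nonneg _) }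

/-- The normed space `Lip₀(M)` of real Lipschitz functions vanishing at the base point `o`; the norm
is the least Lipschitz constant. -/
def Lip0 (o : M) : Type v := lipSubmodule o

instance : NormedAddCommGroup (Lip0 o) :=
  @NormedAddCommGroup.ofCore ℝ (lipSubmodule o) _ _ _ (lipNormInst o) (lipNormCore o)

instance : NormedSpace ℝ (Lip0 o) where
  smul c f := (show lipSubmodule o from c • (show lipSubmodule o from f))
  one_smul f := one_smul ℝ (show lipSubmodule o from f)
  mul_smul a b f := mul_smul a b (show lipSubmodule o from f)
  smul_zero a := smul_zero (A := lipSubmodule o) a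
  smul_add a f g := smul_add (A := lipSubmodule o) a f g
  add_smul a b f := add_smul a b (show lipSubmodule o from f)
  zero_smul f := zero_smul ℝ (show lipSubmodule o from f)
  norm_smul_le c f := lipNorm_smul_le c f

instance : FunLike (Lip0 o) M ℝ where
  coe f := f.1
  coe_injective _ _ h := Subtype.ext h

namespace Lip0

@[simp] theorem add_apply (f g : Lip0 o) (x : M) : (f + g) x = f x + g x := rfl
@[simp] theorem sub_apply (f g : Lip0 o) (x : M) : (f - g) x = f x - g x := rfl
@[simp] theorem zero_apply (x : M) : (0 : Lip0 o) x = 0 := rfl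
@[simp] theorem smul_apply (c : ℝ) (f : Lip0 o) (x : M) : (c • f) x = c * f x := rfl
@[simp] theorem apply_base (f : Lip0 o) : f o = 0 := f.2.1

theorem ext {f g : Lip0 o} (h : ∀ x, f x = g x) : f = g := DFunLike.ext f g h

/-- The function `f` with Lipschitz constant `C` as an element of `Lip₀(M)`. -/
def mk (f : M → ℝ) (h0 : f o = 0) (C : ℝ) (hC : 0 ≤ C)
    (h : ∀ x y, |f x - f y| ≤ C * dist x y) : Lip0 o := ⟨f, h0, C, hC, h⟩

@[simp] theorem mk_apply (f : M → ℝ) (h0 : f o = 0) (C : ℝ) (hC : 0 ≤ C)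
    (h : ∀ x y, |f x - f y| ≤ C * dist x y) (x : M) : mk f h0 C hC h x = f x := rfl

theorem norm_def (f : Lip0 o) :
    ‖f‖ = sInf {C : ℝ | 0 ≤ C ∧ ∀ x y, |f x - f y| ≤ C * dist x y} := rfl

theorem norm_le (f : Lip0 o) {C : ℝ} (hC : 0 ≤ C) (h : ∀ x y, |f x - f y| ≤ C * dist x y) :
    ‖f‖ ≤ C := lipNorm_le f hC h

theorem lipschitz (f : Lip0 o) (x y : M) : |f x - f y| ≤ ‖f‖ * dist x y := le_lipNorm f x y

end Lip0

/-! ### The Lipschitz-free space -/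

/-- The evaluation functional `f ↦ f m` on `Lip₀(M)`. -/
def evalFunctional (o m : M) : StrongDual ℝ (Lip0 o) :=
  LinearMap.mkContinuous
    { toFun := fun f => f m, map_add' := fun _ _ => rfl, map_smul' := fun _ _ => rfl }
    (dist m o) fun f => by
      have h := f.lipschitz m o
      rw [Lip0.apply_base, sub_zero, mul_comm] at h
      exact h

@[simp] theorem evalFunctional_apply (o m : M) (f : Lip0 o) : evalFunctional o m f = f m := rfl

/-- The closed linear span of the evaluation functionals in `Lip₀(M)*`. -/
def freeSubmodule (o : M) : Submodule ℝ (StrongDual ℝ (Lip0 o)) :=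
  (Submodule.span ℝ (Set.range (evalFunctional o))).topologicalClosure

/-- The Lipschitz-free space `F(M)` over `M` with base point `o`. -/
def FreeSpace (o : M) : Type v := freeSubmodule o

instance : NormedAddCommGroup (FreeSpace o) :=
  inferInstanceAs (NormedAddCommGroup (freeSubmodule o))

instance : NormedSpace ℝ (FreeSpace o) := inferInstanceAs (NormedSpace ℝ (freeSubmodule o))

/-- The inclusion of `F(M)` into `Lip₀(M)*`. -/
def incl (o : M) : FreeSpace o →ₗᵢ[ℝ] StrongDual ℝ (Lip0 o) := (freeSubmodule o).subtypeₗᵢ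

theorem incl_mem (o : M) (μ : FreeSpace o) : incl o μ ∈ freeSubmodule o := μ.2

/-- The canonical map `δ : M → F(M)`. -/
def δ (o m : M) : FreeSpace o :=
  ⟨evalFunctional o m,
    Submodule.le_topologicalClosure _ (Submodule.subset_span (Set.mem_range_self m))⟩

@[simp] theorem incl_δ (o m : M) : incl o (δ o m) = evalFunctional o m := rfl

theorem δ_base (o : M) : δ o o = 0 := by
  refine (incl o).injective (ContinuousLinearMap.ext fun f => ?_)
  rw [incl_δ, map_zero, evalFunctional_apply, Lip0.apply_base]
  rfl

theorem norm_δ_sub_le (o x y : M) : ‖δ o x - δ o y‖ ≤ dist x y := by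
  rw [← (incl o).norm_map, map_sub, incl_δ, incl_δ]
  refine ContinuousLinearMap.opNorm_le_bound _ dist_nonneg fun f => ?_
  rw [mul_comm]
  exact f.lipschitz x y

theorem dense_span_δ (o : M) : Dense (Submodule.span ℝ (Set.range (δ o)) : Set (FreeSpace o)) := by
  have hmap : (Submodule.span ℝ (Set.range (δ o))).map (incl o).toLinearMap =
      Submodule.span ℝ (Set.range (evalFunctional o)) := by
    rw [Submodule.map_span, ← Set.range_comp]; rfl
  have himg : incl o '' (Submodule.span ℝ (Set.range (δ o)) : Set (FreeSpace o)) =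
      (Submodule.span ℝ (Set.range (evalFunctional o)) : Set (StrongDual ℝ (Lip0 o))) := by
    rw [← hmap]; rfl
  intro x
  rw [(incl o).isometry.isUniformInducing.isInducing.closure_eq_preimage_closure_image, himg]
  exact incl_mem o x

/-- The function `f` as a functional on `F(M) ⊆ Lip₀(M)*`, acting by evaluation at `f`. -/
def toDual (o : M) (f : Lip0 o) : StrongDual ℝ (FreeSpace o) :=
  (NormedSpace.inclusionInDoubleDual ℝ (Lip0 o) f).comp (incl o).toContinuousLinearMap

theorem toDual_apply (o : M) (f : Lip0 o) (μ : FreeSpace o) : toDual o f μ = incl o μ f := rfl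

theorem toDual_δ (o : M) (f : Lip0 o) (m : M) : toDual o f (δ o m) = f m := rfl

/-- The function `m ↦ φ (δ m)` given by a functional `φ` on `F(M)`. -/
def ofDual (o : M) (φ : StrongDual ℝ (FreeSpace o)) : Lip0 o :=
  Lip0.mk (fun m => φ (δ o m)) (by rw [δ_base, map_zero]) ‖φ‖ (norm_nonneg _) fun x y => by
    rw [← map_sub]
    exact (φ.le_opNorm _).trans (mul_le_mul_of_nonneg_left (norm_δ_sub_le o x y) (norm_nonneg _))

/-- The duality `F(M)* ≡ Lip₀(M)`: the function `f` acts on `F(M) ⊆ Lip₀(M)*` by evaluation at `f`,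
and every bounded functional arises in this way from a unique `f`, with the same norm. -/
def dualEquiv (o : M) : Lip0 o ≃ₗᵢ[ℝ] StrongDual ℝ (FreeSpace o) where
  toFun := toDual o
  map_add' f g := ContinuousLinearMap.ext fun μ => (incl o μ).map_add f g
  map_smul' c f := ContinuousLinearMap.ext fun μ => (incl o μ).map_smul c f
  invFun := ofDual o
  left_inv f := Lip0.ext fun _ => rfl
  right_inv φ := by
    refine ContinuousLinearMap.ext_on (dense_span_δ o) ?_
    rintro _ ⟨m, rfl⟩
    rfl
  norm_map' f := by
    change ‖toDual o f‖ = ‖f‖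
    refine le_antisymm ?_ ?_
    · refine ContinuousLinearMap.opNorm_le_bound _ (norm_nonneg _) fun μ => ?_
      rw [mul_comm, ← (incl o).norm_map]
      exact (incl o μ).le_opNorm f
    · refine f.norm_le (norm_nonneg _) fun x y => ?_
      rw [← toDual_δ, ← toDual_δ, ← map_sub]
      exact ((toDual o f).le_opNorm _).trans
        (mul_le_mul_of_nonneg_left (norm_δ_sub_le o x y) (norm_nonneg _))

@[simp] theorem dualEquiv_apply (o : M) (f : Lip0 o) (μ : FreeSpace o) :
    dualEquiv o f μ = incl o μ f := rfl

end Lip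

/-! ### Adjoint operators -/

section Adjoint

variable {X Y : Type*} [NormedAddCommGroup X] [NormedSpace ℝ X]
  [NormedAddCommGroup Y] [NormedSpace ℝ Y]

/-- The Banach space adjoint `T* : Y* → X*`, `T* φ = φ ∘ T`. -/
def adjointOp (T : X →L[ℝ] Y) : StrongDual ℝ Y →L[ℝ] StrongDual ℝ X :=
  (ContinuousLinearMap.compL ℝ X Y ℝ).flip T

@[simp] theorem adjointOp_apply (T : X →L[ℝ] Y) (φ : StrongDual ℝ Y) (x : X) :
    adjointOp T φ x = φ (T x) := rfl

/-- The operator `R* ∘ κ : X* → X*`, with `κ : X* → X***` the canonical embedding,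
associated with an operator `R : X → X**`. -/
def dualProjection (R : X →L[ℝ] StrongDual ℝ (StrongDual ℝ X)) :
    StrongDual ℝ X →L[ℝ] StrongDual ℝ X :=
  (adjointOp R).comp (NormedSpace.inclusionInDoubleDual ℝ (StrongDual ℝ X))

end Adjoint

/-! ### The actions induced by an isometric action on `M` -/

section Action

variable {G : Type u} [Group G] {M : Type v} [MetricSpace M] [MulAction G M] [IsIsometricSMul G M]

/-- The operator `f ↦ (m ↦ f (g m) - f (g 0))` on `Lip₀(M)`. -/
def lipTranslate (o : M) (g : G) : Lip0 o →L[ℝ] Lip0 o :=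
  LinearMap.mkContinuous
    { toFun := fun f => Lip0.mk (fun m => f (g • m) - f (g • o)) (sub_self _) ‖f‖ (norm_nonneg _)
        fun x y => by
          rw [sub_sub_sub_cancel_right, ← dist_smul g x y]
          exact f.lipschitz _ _
      map_add' := fun f h => Lip0.ext fun x => by
        simp only [Lip0.mk_apply, Lip0.add_apply]; ring
      map_smul' := fun c f => Lip0.ext fun x => by
        simp only [Lip0.mk_apply, Lip0.smul_apply, RingHom.id_apply]; ring }
    1 fun f => by
      rw [one_mul]
      refine Lip0.norm_le _ (norm_nonneg _) fun x y => ?_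
      change |(f (g • x) - f (g • o)) - (f (g • y) - f (g • o))| ≤ _
      rw [sub_sub_sub_cancel_right, ← dist_smul g x y]
      exact f.lipschitz _ _

@[simp] theorem lipTranslate_apply (o : M) (g : G) (f : Lip0 o) (m : M) :
    lipTranslate o g f m = f (g • m) - f (g • o) := rfl

theorem adjointOp_lipTranslate_mem (o : M) (g : G) (μ : FreeSpace o) :
    adjointOp (lipTranslate o g) (incl o μ) ∈ freeSubmodule o := by
  have hspan : Submodule.span ℝ (Set.range (evalFunctional o)) ≤
      (Submodule.span ℝ (Set.range (evalFunctional o))).comap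
        (adjointOp (lipTranslate o g)).toLinearMap := by
    rw [Submodule.span_le]
    rintro _ ⟨m, rfl⟩
    have h : adjointOp (lipTranslate o g) (evalFunctional o m) =
        evalFunctional o (g • m) - evalFunctional o (g • o) :=
      ContinuousLinearMap.ext fun f => rfl
    change adjointOp (lipTranslate o g) (evalFunctional o m) ∈ Submodule.span ℝ _
    rw [h]
    exact Submodule.sub_mem _ (Submodule.subset_span ⟨_, rfl⟩) (Submodule.subset_span ⟨_, rfl⟩)
  have hmaps : Set.MapsTo (adjointOp (lipTranslate o g))
      (Submodule.span ℝ (Set.range (evalFunctional o)) : Set (StrongDual ℝ (Lip0 o)))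
      (Submodule.span ℝ (Set.range (evalFunctional o)) : Set (StrongDual ℝ (Lip0 o))) :=
    fun x hx => hspan hx
  exact hmaps.closure (adjointOp (lipTranslate o g)).continuous (incl_mem o μ)

/-- The linear isometry `T_g` of `F(M)` with `T_g (δ m) = δ (g m) - δ (g 0)`; it is the linear part
of the affine isometry `A_g = T_g + δ (g 0)` of `F(M)` that extends `g : M → M`. -/
def linearAct (o : M) (g : G) : FreeSpace o →L[ℝ] FreeSpace o where
  toFun μ := ⟨adjointOp (lipTranslate o g) (incl o μ), adjointOp_lipTranslate_mem o g μ⟩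
  map_add' μ ν := (incl o).injective ((adjointOp (lipTranslate o g)).map_add (incl o μ) (incl o ν))
  map_smul' c μ := (incl o).injective ((adjointOp (lipTranslate o g)).map_smul c (incl o μ))
  cont := (incl o).isometry.isUniformInducing.isInducing.continuous_iff.2
    ((adjointOp (lipTranslate o g)).continuous.comp (incl o).continuous)

theorem incl_linearAct (o : M) (g : G) (μ : FreeSpace o) :
    incl o (linearAct o g μ) = adjointOp (lipTranslate o g) (incl o μ) := rfl

theorem linearAct_δ (o : M) (g : G) (m : M) :
    linearAct o g (δ o m) = δ o (g • m) - δ o (g • o) := by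
  refine (incl o).injective (ContinuousLinearMap.ext fun f => ?_)
  rw [map_sub]
  rfl

variable (G)

/-- The subspace `I_G` of the elements of `F(M)` that are fixed by all `T_g`. -/
def invariantVectors (o : M) : Submodule ℝ (FreeSpace o) where
  carrier := {μ | ∀ g : G, linearAct o g μ = μ}
  zero_mem' := fun g => map_zero _
  add_mem' := fun {a b} ha hb g => by rw [map_add, ha g, hb g]
  smul_mem' := fun c a ha g => by rw [map_smul, ha g]

end Action

/-- The subspace `Lip₀^G(M)` of the `G`-invariant functions in `Lip₀(M)`. -/
def invariantLip (G : Type u) [Group G] {M : Type v} [MetricSpace M] [MulAction G M] (o : M) :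
    Submodule ℝ (Lip0 o) where
  carrier := {f | ∀ (g : G) (x : M), f x = f (g • x)}
  zero_mem' := fun _ _ => rfl
  add_mem' := fun {a b} ha hb g x => by
    rw [Lip0.add_apply, Lip0.add_apply, ← ha g x, ← hb g x]
  smul_mem' := fun c a ha g x => by rw [Lip0.smul_apply, Lip0.smul_apply, ← ha g x]

/-- The annihilator `A^⊥` of a set `A ⊆ F(M)`, as a subspace of `Lip₀(M) ≡ F(M)*`. -/
def annihilator {M : Type v} [MetricSpace M] {o : M} (A : Set (FreeSpace o)) :
    Submodule ℝ (Lip0 o) where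
  carrier := {f | ∀ μ ∈ A, dualEquiv o f μ = 0}
  zero_mem' := fun μ _ => by rw [map_zero]; rfl
  add_mem' := fun {a b} ha hb μ hμ => by
    rw [map_add, add_apply, ha μ hμ, hb μ hμ, add_zero]
  smul_mem' := fun c a ha μ hμ => by
    rw [map_smul, smul_apply, ha μ hμ, smul_zero]

/-! ### The space of orbit closures -/

section Quotient

variable (G : Type u) [Group G] (M : Type v) [MetricSpace M] [MulAction G M]

/-- `M/G`: the points are the closures of the orbits. -/
def OrbitClosures : Type v :=
  {A : TopologicalSpace.Closeds M // ∃ x : M, (A : Set M) = closure (MulAction.orbit G x)}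

variable {M}

/-- The point `[Gx]` of `M/G`. -/
def OrbitClosures.mk (x : M) : OrbitClosures G M :=
  ⟨⟨closure (MulAction.orbit G x), isClosed_closure⟩, x, rfl⟩

variable {G}

theorem hausdorffEDist_orbit_le [IsIsometricSMul G M] (x y : M) :
    Metric.hausdorffEDist (MulAction.orbit G x) (MulAction.orbit G y) ≤ edist x y := by
  refine Metric.hausdorffEDist_le_of_mem_edist ?_ ?_
  · rintro _ ⟨g, rfl⟩
    exact ⟨g • y, ⟨g, rfl⟩, (edist_smul_left g x y).le⟩
  · rintro _ ⟨g, rfl⟩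
    exact ⟨g • x, ⟨g, rfl⟩, by rw [edist_comm x y]; exact (edist_smul_left g y x).le⟩

instance : EMetricSpace (OrbitClosures G M) :=
  inferInstanceAs (EMetricSpace
    {A : TopologicalSpace.Closeds M // ∃ x : M, (A : Set M) = closure (MulAction.orbit G x)})

theorem OrbitClosures.edist_def (A B : OrbitClosures G M) :
    edist A B = Metric.hausdorffEDist (A.1 : Set M) (B.1 : Set M) := rfl

/-- `M/G` carries the Hausdorff distance between closed sets. -/
instance [IsIsometricSMul G M] : MetricSpace (OrbitClosures G M) :=
  EMetricSpace.toMetricSpace fun A B => by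
    obtain ⟨x, hx⟩ := A.2
    obtain ⟨y, hy⟩ := B.2
    rw [OrbitClosures.edist_def, hx, hy, Metric.hausdorffEDist_closure]
    exact ((hausdorffEDist_orbit_le x y).trans_lt (edist_lt_top x y)).ne

end Quotient

/-! ### Amenable groups, SIN groups and invariant means -/

section Means

variable (G : Type u) [Group G] [TopologicalSpace G]

/-- Bounded functions `f` on `G` such that `x ↦ x⁻¹ · f = (h ↦ f (x h))` is continuous from `G`
to the bounded functions with the supremum norm. -/
def Cblu : Submodule ℝ (G → ℝ) where
  carrier := {f | (∃ C : ℝ, ∀ h, |f h| ≤ C) ∧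
    ∀ x : G, TendstoUniformly (fun y h => f (y * h)) (fun h => f (x * h)) (𝓝 x)}
  zero_mem' := by
    refine ⟨⟨0, by simp⟩, fun x => ?_⟩
    rw [Metric.tendstoUniformly_iff]
    intro ε hε
    simp [hε]
  add_mem' := by
    rintro f g ⟨⟨C, hC⟩, hf⟩ ⟨⟨D, hD⟩, hg⟩
    exact ⟨⟨C + D, fun h => (abs_add_le _ _).trans (add_le_add (hC h) (hD h))⟩,
      fun x => (hf x).add (hg x)⟩
  smul_mem' := by
    rintro c f ⟨⟨C, hC⟩, hf⟩
    refine ⟨⟨|c| * C, fun h => ?_⟩, fun x => ?_⟩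
    · rw [Pi.smul_apply, smul_eq_mul, abs_mul]
      exact mul_le_mul_of_nonneg_left (hC h) (abs_nonneg _)
    · exact (uniformContinuous_const_smul c).comp_tendstoUniformly (hf x)

/-- Bounded functions `f` on `G` such that `x ↦ f · x⁻¹ = (h ↦ f (h x))` is continuous from `G`
to the bounded functions with the supremum norm. -/
def Cbru : Submodule ℝ (G → ℝ) where
  carrier := {f | (∃ C : ℝ, ∀ h, |f h| ≤ C) ∧
    ∀ x : G, TendstoUniformly (fun y h => f (h * y)) (fun h => f (h * x)) (𝓝 x)}
  zero_mem' := by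
    refine ⟨⟨0, by simp⟩, fun x => ?_⟩
    rw [Metric.tendstoUniformly_iff]
    intro ε hε
    simp [hε]
  add_mem' := by
    rintro f g ⟨⟨C, hC⟩, hf⟩ ⟨⟨D, hD⟩, hg⟩
    exact ⟨⟨C + D, fun h => (abs_add_le _ _).trans (add_le_add (hC h) (hD h))⟩,
      fun x => (hf x).add (hg x)⟩
  smul_mem' := by
    rintro c f ⟨⟨C, hC⟩, hf⟩
    refine ⟨⟨|c| * C, fun h => ?_⟩, fun x => ?_⟩
    · rw [Pi.smul_apply, smul_eq_mul, abs_mul]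
      exact mul_le_mul_of_nonneg_left (hC h) (abs_nonneg _)
    · exact (uniformContinuous_const_smul c).comp_tendstoUniformly (hf x)

/-- The functions in both of the previous spaces. -/
def Cbu : Submodule ℝ (G → ℝ) := Cblu G ⊓ Cbru G

variable {G} in
/-- The essentially bounded measurable functions on `G`; the elements of `L_∞(G, μ)` are their
classes modulo equality almost everywhere. -/
def Linf [MeasurableSpace G] (μ : Measure G) : Submodule ℝ (G → ℝ) where
  carrier := {f | MemLp f ∞ μ}
  zero_mem' := MemLp.zero
  add_mem' := fun hf hg => hf.add hg
  smul_mem' := fun c _ hf => hf.const_smul c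

variable {G}

/-- `m` is a left-invariant mean on the function space `D`. -/
structure IsLeftInvariantMean (D : Submodule ℝ (G → ℝ)) (m : D →ₗ[ℝ] ℝ) : Prop where
  map_one : ∀ f : D, (∀ h, (f : G → ℝ) h = 1) → m f = 1
  nonneg : ∀ f : D, (∀ h, 0 ≤ (f : G → ℝ) h) → 0 ≤ m f
  left_inv : ∀ (g : G) (f f' : D), (∀ h, (f' : G → ℝ) h = (f : G → ℝ) (g⁻¹ * h)) → m f' = m f

variable (G) in
/-- Amenability: there is a left-invariant mean on the bounded left-uniformly continuous
functions. -/
def IsAmenable : Prop := ∃ m : Cblu G →ₗ[ℝ] ℝ, IsLeftInvariantMean (Cblu G) m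

variable (G) in
/-- Small invariant neighbourhoods. -/
def IsSIN : Prop :=
  ∀ U ∈ 𝓝 (1 : G), ∃ V ∈ 𝓝 (1 : G), V ⊆ U ∧ ∀ g : G, (fun v => g * v * g⁻¹) '' V = V

/-- The domains of the bi-invariant means: `D` is the space of functions and `l` is the filter for
which `f ≤ g` in `D` means `f ≤ g` eventually along `l`. Either `G` is locally compact, `D` is
`L_∞(G, μ)` for a Haar measure `μ` and the order is the almost everywhere order, or `G` is SIN, `D`
is the space of bounded left and right uniformly continuous functions and the order is the pointwise
order (the filter `⊤`). -/
def IsMeanDomain [MeasurableSpace G] (l : Filter G) (D : Submodule ℝ (G → ℝ)) : Prop :=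
  (LocallyCompactSpace G ∧ ∃ μ : Measure G, μ.IsHaarMeasure ∧ μ.Regular ∧ l = ae μ ∧ D = Linf μ) ∨
  (IsSIN G ∧ l = ⊤ ∧ D = Cbu G)

/-- `m` is a bi-invariant mean on `D`, positive for the order along `l`. For `D = L_∞(G, μ)` and
`l = ae μ`, positivity makes `m` vanish on the functions that are zero almost everywhere, so these
are exactly the bi-invariant means on the space of classes. -/
structure IsBiInvariantMean (l : Filter G) (D : Submodule ℝ (G → ℝ)) (m : D →ₗ[ℝ] ℝ) : Prop where
  map_one : ∀ f : D, (∀ h, (f : G → ℝ) h = 1) → m f = 1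
  nonneg : ∀ f : D, (∀ᶠ h in l, 0 ≤ (f : G → ℝ) h) → 0 ≤ m f
  left_inv : ∀ (g : G) (f f' : D), (∀ h, (f' : G → ℝ) h = (f : G → ℝ) (g⁻¹ * h)) → m f' = m f
  right_inv : ∀ (g : G) (f f' : D), (∀ h, (f' : G → ℝ) h = (f : G → ℝ) (h * g⁻¹)) → m f' = m f

end Means

end LipFree

end

/-! Write X for the free space and N for the closed span of the elements δ(gx) - δ(x)
(`orbitDifferences`). Under the duality with Lipschitz functions, the annihilator of N is exactly
the space of invariant functions (`exists_invariantLip_of_vanishing`). The averaging operator R and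
the linearized quotient map from X to the free space of the orbit closures are two contractions that
vanish on N and do not lose the values of invariant functionals: R x f = f(x) for invariant f, and
every invariant f factors isometrically through the orbit closures (`range_lipPullback`). By
Hahn-Banach a class in X/N is normed by an invariant functional, so both operators induce the
quotient norm of X/N (`norm_apply_eq_norm_mk`). Hence ker R = N, the range of R is closed, and it is
isometric to X/N and so to the free space of the quotient.

That R vanishes on N is where right invariance and bounded orbits enter (`averagingOp_δ_smul`). The
dual operator then maps into the invariant functions and fixes them, so it is a projection. On fixed
vectors R is the canonical embedding, so X → X/N is isometric on I_G; if no nonzero invariant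
function annihilates I_G, this restriction is onto and its inverse yields the projection.

A bi-invariant mean comes from applying a right-invariant mean inside a left-invariant one. In a SIN
group left and right uniform continuity agree, so inversion produces the right-invariant mean. In a
locally compact group, convolution with a compactly supported kernel carries L_∞ into the left
uniformly continuous functions; uniqueness of Haar measure shows that the mean of φ * f depends on φ
only through its integral, and this lets left-invariant means be extended to L_∞
(`exists_mean_Linf`). -/

namespace LipFree

universe u v

/-! ### Operators inducing a quotient norm -/

section QuotientNorm

variable {X Y Z : Type*} [NormedAddCommGroup X] [NormedSpace ℝ X]
  [NormedAddCommGroup Y] [NormedSpace ℝ Y] [NormedAddCommGroup Z] [NormedSpace ℝ Z]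

/-- An operator `T` of norm at most one vanishing on `N`, whose norms are attained by the
functionals vanishing on `N`, induces an isometry on `X ⧸ N`. -/
theorem norm_apply_eq_norm_mk (N : Submodule ℝ X) (T : X →L[ℝ] Y)
    (hT : ∀ x, ‖T x‖ ≤ ‖x‖) (hN : ∀ x ∈ N, T x = 0)
    (h : ∀ φ : StrongDual ℝ X, ‖φ‖ ≤ 1 → (∀ x ∈ N, φ x = 0) → ∀ x, φ x ≤ ‖T x‖) (x : X) :
    ‖T x‖ = ‖(Submodule.Quotient.mk x : X ⧸ N)‖ := by
  refine le_antisymm ?_ ?_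
  · refine le_of_forall_pos_le_add fun ε hε => ?_
    obtain ⟨y, hy, hyε⟩ := Submodule.Quotient.norm_mk_lt (Submodule.Quotient.mk x : X ⧸ N) hε
    have hxy : T x = T y := by
      have := hN _ ((Submodule.Quotient.eq N).1 hy)
      rw [map_sub, sub_eq_zero] at this
      exact this.symm
    rw [hxy]
    exact (hT y).trans hyε.le
  -- A functional norming the class of `x` in the quotient pulls back to a contractive functional
  -- vanishing on `N`, to which `h` applies.
  · obtain ⟨ψ, hψ, hψx⟩ := exists_dual_vector'' ℝ (Submodule.Quotient.mk x : X ⧸ N)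
    let φ : StrongDual ℝ X := (ψ.toLinearMap.comp N.mkQ).mkContinuous 1 fun z => by
      refine (ψ.le_of_opNorm_le hψ _).trans ?_
      rw [one_mul, one_mul]
      exact Submodule.Quotient.norm_mk_le _ z
    have hφ : ∀ z, φ z = ψ (Submodule.Quotient.mk z) := fun _ => rfl
    have h1 := h φ (LinearMap.mkContinuous_norm_le _ zero_le_one _) (fun z hz => by
      rw [hφ, (Submodule.Quotient.mk_eq_zero N).2 hz, map_zero]) x
    rw [hφ, hψx] at h1
    exact h1

/-- The isometry between a quotient and the range of an operator inducing the quotient norm. -/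
noncomputable def rangeIsometryOfNormEq (N : Submodule ℝ X) [IsClosed (N : Set X)] (T : X →L[ℝ] Y)
    (hT : ∀ x, ‖T x‖ = ‖(Submodule.Quotient.mk x : X ⧸ N)‖) : (X ⧸ N) ≃ₗᵢ[ℝ] T.range :=
  have hN : N ≤ T.ker := fun x hx => by
    change T x = 0
    rw [← norm_eq_zero, hT, (Submodule.Quotient.mk_eq_zero N).2 hx, norm_zero]
  let L : (X ⧸ N) →ₗᵢ[ℝ] Y :=
    { N.liftQ T.toLinearMap hN with
      norm_map' := fun x => by
        obtain ⟨x, rfl⟩ := Submodule.Quotient.mk_surjective N x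
        exact hT x }
  have hL : L.toLinearMap.range = T.range := Submodule.range_liftQ N T.toLinearMap hN
  L.equivRange.trans (LinearIsometryEquiv.ofEq _ _ hL)

theorem ker_eq_of_norm_eq (N : Submodule ℝ X) [IsClosed (N : Set X)] (T : X →L[ℝ] Y)
    (hT : ∀ x, ‖T x‖ = ‖(Submodule.Quotient.mk x : X ⧸ N)‖) : T.ker = N := by
  ext x
  change T x = 0 ↔ _
  rw [← norm_eq_zero, hT, norm_eq_zero, Submodule.Quotient.mk_eq_zero]

theorem isClosed_range_of_norm_eq [CompleteSpace X] (N : Submodule ℝ X) [IsClosed (N : Set X)]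
    (T : X →L[ℝ] Y) (hT : ∀ x, ‖T x‖ = ‖(Submodule.Quotient.mk x : X ⧸ N)‖) :
    IsClosed (Set.range T) := by
  have e := rangeIsometryOfNormEq N T hT
  have : CompleteSpace T.range :=
    (completeSpace_congr (e := e.toEquiv) e.isometry.isUniformEmbedding).1 inferInstance
  have h : IsComplete (T.range : Set Y) := completeSpace_coe_iff_isComplete.1 this
  exact h.isClosed

/-- The ranges of two operators inducing the same quotient norm are isometric. -/
theorem nonempty_range_isometry [CompleteSpace X] (N : Submodule ℝ X) [IsClosed (N : Set X)]
    (T : X →L[ℝ] Y) (S : X →L[ℝ] Z) (hT : ∀ x, ‖T x‖ = ‖(Submodule.Quotient.mk x : X ⧸ N)‖)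
    (hS : ∀ x, ‖S x‖ = ‖(Submodule.Quotient.mk x : X ⧸ N)‖) (hd : DenseRange S) :
    Nonempty (T.range ≃ₗᵢ[ℝ] Z) := by
  -- The range of `S` is closed, being isometric to a complete quotient, and dense by `hd`.
  have h : S.range = ⊤ := by
    rw [eq_top_iff]
    intro z _
    have := (isClosed_range_of_norm_eq N S hS).closure_eq
    rw [hd.closure_range] at this
    change z ∈ Set.range S
    rw [← this]
    trivial
  exact ⟨((rangeIsometryOfNormEq N T hT).symm.trans (rangeIsometryOfNormEq N S hS)).trans
    ((LinearIsometryEquiv.ofEq _ _ h).trans (LinearIsometryEquiv.ofTop Z ⊤ rfl))⟩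

/-- Hahn-Banach: a point outside a closed subspace is separated from it by a functional. -/
theorem exists_dual_ne_zero_of_notMem (N : Submodule ℝ X) (hN : IsClosed (N : Set X)) {x : X}
    (hx : x ∉ N) : ∃ ψ : StrongDual ℝ X, (∀ y ∈ N, ψ y = 0) ∧ ψ x ≠ 0 := by
  obtain ⟨ψ, hψ, hψx⟩ := exists_dual_vector'' ℝ (Submodule.Quotient.mk x : X ⧸ N)
  refine ⟨(ψ.toLinearMap.comp N.mkQ).mkContinuous 1 fun z => ?_, ?_, ?_⟩
  · refine (ψ.le_of_opNorm_le hψ _).trans ?_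
    rw [one_mul, one_mul]
    exact Submodule.Quotient.norm_mk_le _ z
  · intro y hy
    change ψ (Submodule.Quotient.mk y) = 0
    rw [(Submodule.Quotient.mk_eq_zero _).2 hy, map_zero]
  · change ψ (Submodule.Quotient.mk x) ≠ 0
    rw [hψx]
    intro h0
    have h1 : ‖(Submodule.Quotient.mk x : X ⧸ N)‖ = 0 := h0
    exact hx ((Submodule.Quotient.mk_eq_zero N).1 (norm_eq_zero.1 h1))

/-- If `X → X ⧸ N` is isometric on the closed subspace `I` and no nonzero functional vanishes on
both `N` and `I`, then `I` is the range of a projection of norm at most one. -/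
theorem exists_projection_of_norm_mk_eq [CompleteSpace X] (N I : Submodule ℝ X)
    [IsClosed (N : Set X)] (hI : IsClosed (I : Set X))
    (hIN : ∀ x ∈ I, ‖(Submodule.Quotient.mk x : X ⧸ N)‖ = ‖x‖)
    (h : ∀ φ : StrongDual ℝ X, (∀ x ∈ N, φ x = 0) → (∀ x ∈ I, φ x = 0) → φ = 0) :
    ∃ P : X →L[ℝ] X, IsIdempotentElem P ∧ ‖P‖ ≤ 1 ∧ Set.range P = (I : Set X) := by
  let L : I →ₗᵢ[ℝ] X ⧸ N :=
    { N.mkQ.comp I.subtype with norm_map' := fun x => hIN x.1 x.2 }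
  have : CompleteSpace I := hI.isComplete.completeSpace_coe
  have hclosed : IsClosed (L.toLinearMap.range : Set (X ⧸ N)) :=
    L.isometry.isClosedEmbedding.isClosed_range
  -- The image of `I` is closed. If it were proper, a nonzero functional on the quotient vanishing
  -- on it would pull back to one vanishing on both `N` and `I`.
  have hsurj : Function.Surjective L := by
    by_contra hns
    simp only [Function.Surjective, not_forall] at hns
    obtain ⟨z, hz⟩ := hns
    have hz' : z ∉ L.toLinearMap.range := fun h => hz h
    obtain ⟨ψ, hψ, hψz⟩ := exists_dual_ne_zero_of_notMem _ hclosed hz'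
    obtain ⟨x, rfl⟩ := Submodule.Quotient.mk_surjective N z
    let φ : StrongDual ℝ X := (ψ.toLinearMap.comp N.mkQ).mkContinuous ‖ψ‖ fun z =>
      (ψ.le_opNorm _).trans
        (mul_le_mul_of_nonneg_left (Submodule.Quotient.norm_mk_le _ z) (norm_nonneg _))
    have hφ : ∀ z, φ z = ψ (Submodule.Quotient.mk z) := fun _ => rfl
    have h0 := h φ (fun y hy => by
      rw [hφ, (Submodule.Quotient.mk_eq_zero N).2 hy, map_zero])
      (fun y hy => hψ _ ⟨⟨y, hy⟩, rfl⟩)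
    exact hψz (by rw [← hφ, h0]; rfl)
  let e := LinearIsometryEquiv.ofSurjective L hsurj
  have he : ∀ x : I, e x = Submodule.Quotient.mk (x : X) := fun _ => rfl
  let P : X →L[ℝ] X :=
    (I.subtype.comp (e.symm.toLinearEquiv.toLinearMap.comp N.mkQ)).mkContinuous 1 fun x => by
      change ‖((e.symm (Submodule.Quotient.mk x) : I) : X)‖ ≤ _
      rw [← Submodule.coe_norm, e.symm.norm_map, one_mul]
      exact Submodule.Quotient.norm_mk_le _ x
  have hP : ∀ x, P x = (e.symm (Submodule.Quotient.mk x) : I) := fun _ => rfl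
  have hPI : ∀ x ∈ I, P x = x := fun x hx => by
    rw [hP, ← he ⟨x, hx⟩, e.symm_apply_apply]
  have hmem : ∀ x, P x ∈ I := fun x => (e.symm (Submodule.Quotient.mk x)).2
  refine ⟨P, ContinuousLinearMap.ext fun x => hPI _ (hmem x),
    LinearMap.mkContinuous_norm_le _ zero_le_one _, Set.Subset.antisymm ?_ ?_⟩
  · rintro _ ⟨x, rfl⟩
    exact hmem x
  · exact fun x hx => ⟨x, hPI x hx⟩

end QuotientNorm

/-! ### Completeness and duality of the free space -/

section FreeSpace

variable {M : Type v} [MetricSpace M] (o : M)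

instance : CompleteSpace (FreeSpace o) :=
  (Submodule.isClosed_topologicalClosure
    (Submodule.span ℝ (Set.range (evalFunctional o)))).isComplete.completeSpace_coe

theorem dualEquiv_δ (f : Lip0 o) (m : M) : dualEquiv o f (δ o m) = f m := rfl

end FreeSpace

/-! ### The linear action on the free space -/

section Action

variable {G : Type u} [Group G] {M : Type v} [MetricSpace M] [MulAction G M] [IsIsometricSMul G M]
  (o : M)

theorem norm_adjointOp_le {X Y : Type*} [NormedAddCommGroup X] [NormedSpace ℝ X]
    [NormedAddCommGroup Y] [NormedSpace ℝ Y] (T : X →L[ℝ] Y) : ‖adjointOp T‖ ≤ ‖T‖ :=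
  ContinuousLinearMap.opNorm_le_bound _ (norm_nonneg _) fun φ => by
    rw [mul_comm]
    exact φ.opNorm_comp_le T

theorem norm_lipTranslate_le (g : G) : ‖lipTranslate o g‖ ≤ 1 :=
  LinearMap.mkContinuous_norm_le _ zero_le_one _

theorem norm_linearAct_apply_le (g : G) (x : FreeSpace o) : ‖linearAct o g x‖ ≤ ‖x‖ := by
  rw [← (incl o).norm_map, incl_linearAct, ← (incl o).norm_map x]
  refine (ContinuousLinearMap.le_of_opNorm_le _
    ((norm_adjointOp_le _).trans (norm_lipTranslate_le o g)) _).trans (one_mul _).le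

theorem linearAct_mul (g h : G) (x : FreeSpace o) :
    linearAct o (g * h) x = linearAct o g (linearAct o h x) := by
  have : linearAct o (g * h) = (linearAct o g).comp (linearAct o h) := by
    refine ContinuousLinearMap.ext_on (dense_span_δ o) ?_
    rintro _ ⟨m, rfl⟩
    change _ = linearAct o g (linearAct o h (δ o m))
    rw [linearAct_δ, linearAct_δ, map_sub, linearAct_δ, linearAct_δ, mul_smul, mul_smul]
    abel
  rw [this]
  rfl

/-- On generators this is continuity of the action, and it passes to linear combinations. The
contractions T_g allow an ε/3 approximation that is uniform in `g`. -/
theorem continuous_linearAct [TopologicalSpace G] [ContinuousSMul G M] (x : FreeSpace o) :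
    Continuous fun g : G => linearAct o g x := by
  have hδ : Continuous (δ o) := by
    refine (LipschitzWith.of_dist_le_mul (K := 1) fun x y => ?_).continuous
    rw [dist_eq_norm, NNReal.coe_one, one_mul]
    exact norm_δ_sub_le o x y
  have hspan : ∀ y ∈ Submodule.span ℝ (Set.range (δ o)),
      Continuous fun g : G => linearAct o g y := by
    intro y hy
    induction hy using Submodule.span_induction with
    | mem y hy =>
      obtain ⟨m, rfl⟩ := hy
      simp only [linearAct_δ]
      exact (hδ.comp (continuous_id.smul continuous_const)).sub
        (hδ.comp (continuous_id.smul continuous_const))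
    | zero => simpa only [map_zero] using continuous_const
    | add y z _ _ hy hz => simp only [map_add]; exact hy.add hz
    | smul c y _ hy => simp only [map_smul]; exact hy.const_smul c
  rw [Metric.continuous_iff']
  intro g ε hε
  obtain ⟨y, hy, hxy⟩ := Metric.mem_closure_iff.1 (dense_span_δ o x) (ε / 3) (by positivity)
  rw [dist_eq_norm] at hxy
  filter_upwards [Metric.continuous_iff'.1 (hspan y hy) g (ε / 3) (by positivity)] with h hh
  have hb : ∀ k : G, dist (linearAct o k x) (linearAct o k y) < ε / 3 := fun k => by
    rw [dist_eq_norm, ← map_sub]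
    exact (norm_linearAct_apply_le o k _).trans_lt hxy
  calc dist (linearAct o h x) (linearAct o g x)
      ≤ dist (linearAct o h x) (linearAct o h y) + dist (linearAct o h y) (linearAct o g y) +
        dist (linearAct o g y) (linearAct o g x) := dist_triangle4 _ _ _ _
    _ < ε / 3 + ε / 3 + ε / 3 := by
      refine add_lt_add (add_lt_add (hb h) hh) ?_
      rw [dist_comm]
      exact hb g
    _ = ε := by ring

theorem isClosed_invariantVectors : IsClosed (invariantVectors G o : Set (FreeSpace o)) := by
  have : (invariantVectors G o : Set (FreeSpace o)) =
      ⋂ g : G, {x | linearAct o g x = x} := by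
    ext x
    simp only [Set.mem_iInter]
    rfl
  rw [this]
  exact isClosed_iInter fun g => isClosed_eq (linearAct o g).continuous continuous_id

/-- Orbit maps composed with Lipschitz functions are right uniformly continuous. -/
theorem comp_smul_mem_Cbru [TopologicalSpace G] [ContinuousSMul G M] (f : Lip0 o) (x : M)
    (hx : Bornology.IsBounded (MulAction.orbit G x)) : (fun g : G => f (g • x)) ∈ Cbru G := by
  constructor
  · obtain ⟨C, hC⟩ := hx.subset_closedBall o
    refine ⟨‖f‖ * C, fun g => ?_⟩
    have h := f.lipschitz (g • x) o
    rw [Lip0.apply_base, sub_zero] at h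
    exact h.trans (mul_le_mul_of_nonneg_left (hC ⟨g, rfl⟩) (norm_nonneg _))
  · intro g
    rw [Metric.tendstoUniformly_iff]
    intro ε hε
    have hc : Filter.Tendsto (fun k : G => ‖f‖ * dist (g • x) (k • x)) (𝓝 g) (𝓝 0) := by
      have : Continuous fun k : G => ‖f‖ * dist (g • x) (k • x) := by fun_prop
      simpa using this.tendsto g
    filter_upwards [hc.eventually_lt_const hε] with k hk h
    refine lt_of_le_of_lt ?_ hk
    rw [Real.dist_eq, mul_smul, mul_smul, ← dist_smul h (g • x)]
    exact f.lipschitz _ _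

/-- Since T_{hk}x - T_{hg}x = T_h(T_k x - T_g x) and T_h is a contraction, strong continuity at `g`
becomes uniform in `h`. This places the integrand of the averaging operator in the domain of the
mean. -/
theorem apply_linearAct_mem_Cbru [TopologicalSpace G] [ContinuousSMul G M]
    (φ : StrongDual ℝ (FreeSpace o)) (x : FreeSpace o) :
    (fun g : G => φ (linearAct o g x)) ∈ Cbru G := by
  constructor
  · exact ⟨‖φ‖ * ‖x‖, fun g => (φ.le_opNorm _).trans
      (mul_le_mul_of_nonneg_left (norm_linearAct_apply_le o g x) (norm_nonneg _))⟩
  · intro g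
    rw [Metric.tendstoUniformly_iff]
    intro ε hε
    have hc : Filter.Tendsto (fun k : G => ‖φ‖ * ‖linearAct o g x - linearAct o k x‖) (𝓝 g)
        (𝓝 0) := by
      have : Continuous fun k : G => ‖φ‖ * ‖linearAct o g x - linearAct o k x‖ :=
        continuous_const.mul (continuous_const.sub (continuous_linearAct o x)).norm
      simpa using this.tendsto g
    filter_upwards [hc.eventually_lt_const hε] with k hk h
    refine lt_of_le_of_lt ?_ hk
    rw [Real.dist_eq, linearAct_mul, linearAct_mul, ← map_sub, ← map_sub]
    exact (φ.le_opNorm _).trans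
      (mul_le_mul_of_nonneg_left (norm_linearAct_apply_le o h _) (norm_nonneg _))

end Action

/-! ### Orbit closures and the span of orbit differences -/

section Quotient

variable {G : Type u} [Group G] {M : Type v} [MetricSpace M] [MulAction G M] (o : M)

theorem OrbitClosures.mk_smul (g : G) (x : M) :
    OrbitClosures.mk G (g • x) = OrbitClosures.mk G x := by
  refine Subtype.ext (TopologicalSpace.Closeds.ext ?_)
  change closure (MulAction.orbit G (g • x)) = closure (MulAction.orbit G x)
  rw [MulAction.orbit_eq_iff.2 ⟨g, rfl⟩]

theorem OrbitClosures.mk_surjective :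
    Function.Surjective (OrbitClosures.mk G : M → OrbitClosures G M) := fun A => by
  obtain ⟨x, hx⟩ := A.2
  exact ⟨x, Subtype.ext (TopologicalSpace.Closeds.ext hx.symm)⟩

variable (G) in
/-- The closed linear span of the elements `δ (g x) - δ x`. -/
noncomputable def orbitDifferences : Submodule ℝ (FreeSpace o) :=
  (Submodule.span ℝ
    {z | ∃ (x : M) (g : G), z = δ o (g • x) - δ o x}).topologicalClosure

instance : IsClosed (orbitDifferences G o : Set (FreeSpace o)) :=
  Submodule.isClosed_topologicalClosure _

theorem apply_eq_zero_of_mem_orbitDifferences {Y : Type*} [NormedAddCommGroup Y] [NormedSpace ℝ Y]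
    (T : FreeSpace o →L[ℝ] Y) (h : ∀ (x : M) (g : G), T (δ o (g • x)) = T (δ o x))
    {z : FreeSpace o} (hz : z ∈ orbitDifferences G o) : T z = 0 := by
  have : orbitDifferences G o ≤ T.ker := by
    refine Submodule.topologicalClosure_minimal _ ?_ T.isClosed_ker
    rw [Submodule.span_le]
    rintro _ ⟨x, g, rfl⟩
    change T _ = 0
    rw [map_sub, h, sub_self]
  exact this hz

/-- Vanishing on δ(gx) - δ(x) is precisely the equation f(gx) = f(x) for the function representing
`φ`. -/
theorem exists_invariantLip_of_vanishing (φ : StrongDual ℝ (FreeSpace o))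
    (hφ : ∀ z ∈ orbitDifferences G o, φ z = 0) :
    ∃ f ∈ invariantLip G o, dualEquiv o f = φ := by
  refine ⟨(dualEquiv o).symm φ, fun g x => ?_, (dualEquiv o).apply_symm_apply φ⟩
  rw [← dualEquiv_δ, ← dualEquiv_δ, (dualEquiv o).apply_symm_apply, eq_comm, ← sub_eq_zero,
    ← map_sub]
  exact hφ _ (Submodule.le_topologicalClosure _ (Submodule.subset_span ⟨x, g, rfl⟩))

end Quotient

/-! ### The free space of the orbit closures as a quotient -/

section Quotient

variable {G : Type u} [Group G] {M : Type v} [MetricSpace M] [MulAction G M] [IsIsometricSMul G M]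
  (o : M)

theorem OrbitClosures.dist_mk_le (x y : M) :
    dist (OrbitClosures.mk G x) (OrbitClosures.mk G y) ≤ dist x y := by
  rw [dist_edist, dist_edist]
  refine ENNReal.toReal_mono (edist_ne_top _ _) ?_
  rw [OrbitClosures.edist_def]
  change Metric.hausdorffEDist (closure (MulAction.orbit G x)) (closure (MulAction.orbit G y)) ≤ _
  rw [Metric.hausdorffEDist_closure]
  exact hausdorffEDist_orbit_le x y

/-- Passing to closures does not change the Hausdorff distance, so an actual point of the orbit of
`y` can be chosen near `x`. -/
theorem OrbitClosures.exists_dist_smul_lt (x y : M) {r : ℝ}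
    (h : dist (OrbitClosures.mk G x) (OrbitClosures.mk G y) < r) :
    ∃ g : G, dist x (g • y) < r := by
  have hr : 0 < r := dist_nonneg.trans_lt h
  have h' : Metric.hausdorffEDist (MulAction.orbit G x) (MulAction.orbit G y) <
      ENNReal.ofReal r := by
    rw [← Metric.hausdorffEDist_closure]
    rw [dist_edist] at h
    exact (ENNReal.lt_ofReal_iff_toReal_lt (edist_ne_top _ _)).2 h
  obtain ⟨_, ⟨g, rfl⟩, hg⟩ :=
    Metric.exists_edist_lt_of_hausdorffEDist_lt (MulAction.mem_orbit_self x) h'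
  refine ⟨g, ?_⟩
  rw [edist_dist] at hg
  exact (ENNReal.ofReal_lt_ofReal_iff hr).1 hg

/-- An invariant function with Lipschitz constant `C` satisfies the same bound for the Hausdorff
distance of orbit closures. -/
theorem abs_sub_le_dist_mk {f : M → ℝ} {C : ℝ} (hC : 0 ≤ C)
    (hf : ∀ x y, |f x - f y| ≤ C * dist x y) (hG : ∀ (g : G) (x : M), f x = f (g • x)) (x y : M) :
    |f x - f y| ≤ C * dist (OrbitClosures.mk G x) (OrbitClosures.mk G y) := by
  refine le_of_forall_pos_le_add fun ε hε => ?_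
  -- The denominator `C + 1` keeps the error positive when `C = 0`, while `C * (ε / (C + 1)) ≤ ε`.
  obtain ⟨g, hg⟩ := OrbitClosures.exists_dist_smul_lt x y
    (lt_add_of_pos_right (dist (OrbitClosures.mk G x) (OrbitClosures.mk G y))
      (show 0 < ε / (C + 1) by positivity))
  rw [hG g y]
  refine (hf _ _).trans ((mul_le_mul_of_nonneg_left hg.le hC).trans ?_)
  rw [mul_add]
  have : C * (ε / (C + 1)) ≤ ε := by
    rw [mul_div_assoc', div_le_iff₀ (by positivity)]
    nlinarith
  linarith

variable (G) in
/-- The isometric embedding `f ↦ f ∘ q` of `Lip₀(M/G)` into `Lip₀(M)`. -/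
noncomputable def lipPullback : Lip0 (OrbitClosures.mk G o) →ₗᵢ[ℝ] Lip0 o where
  toFun f := Lip0.mk (fun x => f (OrbitClosures.mk G x)) f.apply_base ‖f‖ (norm_nonneg _)
    fun x y => (f.lipschitz _ _).trans
      (mul_le_mul_of_nonneg_left (OrbitClosures.dist_mk_le x y) (norm_nonneg _))
  map_add' _ _ := rfl
  map_smul' _ _ := rfl
  norm_map' f := by
    refine le_antisymm (Lip0.norm_le _ (norm_nonneg _) fun x y => (f.lipschitz _ _).trans
      (mul_le_mul_of_nonneg_left (OrbitClosures.dist_mk_le x y) (norm_nonneg _))) ?_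
    refine Lip0.norm_le _ (norm_nonneg _) fun A B => ?_
    obtain ⟨x, rfl⟩ := OrbitClosures.mk_surjective A
    obtain ⟨y, rfl⟩ := OrbitClosures.mk_surjective B
    exact abs_sub_le_dist_mk (f := fun x => f (OrbitClosures.mk G x)) (norm_nonneg _)
      (Lip0.lipschitz (Lip0.mk (fun x => f (OrbitClosures.mk G x)) f.apply_base ‖f‖
        (norm_nonneg _) fun x y => (f.lipschitz _ _).trans
          (mul_le_mul_of_nonneg_left (OrbitClosures.dist_mk_le x y) (norm_nonneg _))))
      (fun g x => by rw [OrbitClosures.mk_smul]) x y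

@[simp] theorem lipPullback_apply (f : Lip0 (OrbitClosures.mk G o)) (x : M) :
    lipPullback G o f x = f (OrbitClosures.mk G x) := rfl

theorem range_lipPullback :
    Set.range (lipPullback G o) = (invariantLip G o : Set (Lip0 o)) := by
  refine Set.Subset.antisymm ?_ fun f hf => ?_
  · rintro _ ⟨f, rfl⟩ g x
    rw [lipPullback_apply, lipPullback_apply, OrbitClosures.mk_smul]
  · have key : ∀ x y : M, |f x - f y| ≤
        ‖f‖ * dist (OrbitClosures.mk G x) (OrbitClosures.mk G y) :=
      abs_sub_le_dist_mk (norm_nonneg _) f.lipschitz hf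
    -- Two points with the same orbit closure may lie in different orbits; `key` with distance zero
    -- still gives them the same value.
    have hrep : ∀ x : M,
        f (Function.surjInv OrbitClosures.mk_surjective (OrbitClosures.mk G x)) = f x := fun x => by
      have := key (Function.surjInv OrbitClosures.mk_surjective (OrbitClosures.mk G x)) x
      rw [Function.surjInv_eq OrbitClosures.mk_surjective, dist_self, mul_zero] at this
      exact sub_eq_zero.1 (abs_nonpos_iff.1 this)
    refine ⟨Lip0.mk (fun A => f (Function.surjInv OrbitClosures.mk_surjective A))
      (by rw [hrep, Lip0.apply_base]) ‖f‖ (norm_nonneg _) fun A B => ?_, Lip0.ext fun x => hrep x⟩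
    refine (key _ _).trans ?_
    rw [Function.surjInv_eq OrbitClosures.mk_surjective,
      Function.surjInv_eq OrbitClosures.mk_surjective]

variable (G) in
/-- The linearization `F(M) → F(M/G)` of the quotient map. -/
noncomputable def freeQuotient : FreeSpace o →L[ℝ] FreeSpace (OrbitClosures.mk G o) where
  toFun μ := ⟨adjointOp (lipPullback G o).toContinuousLinearMap (incl o μ), by
    have hspan : Submodule.span ℝ (Set.range (evalFunctional o)) ≤
        (Submodule.span ℝ (Set.range (evalFunctional (OrbitClosures.mk G o)))).comap
          (adjointOp (lipPullback G o).toContinuousLinearMap).toLinearMap := by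
      rw [Submodule.span_le]
      rintro _ ⟨m, rfl⟩
      exact Submodule.subset_span ⟨OrbitClosures.mk G m, rfl⟩
    have hmaps : Set.MapsTo (adjointOp (lipPullback G o).toContinuousLinearMap)
        (Submodule.span ℝ (Set.range (evalFunctional o)) : Set _)
        (Submodule.span ℝ (Set.range (evalFunctional (OrbitClosures.mk G o))) : Set _) :=
      fun x hx => hspan hx
    exact hmaps.closure (adjointOp (lipPullback G o).toContinuousLinearMap).continuous
      (incl_mem o μ)⟩
  map_add' μ ν := (incl _).injective
    ((adjointOp (lipPullback G o).toContinuousLinearMap).map_add (incl o μ) (incl o ν))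
  map_smul' c μ := (incl _).injective
    ((adjointOp (lipPullback G o).toContinuousLinearMap).map_smul c (incl o μ))
  cont := (incl _).isometry.isUniformInducing.isInducing.continuous_iff.2
    ((adjointOp (lipPullback G o).toContinuousLinearMap).continuous.comp (incl o).continuous)

theorem incl_freeQuotient (μ : FreeSpace o) : incl _ (freeQuotient G o μ) =
    adjointOp (lipPullback G o).toContinuousLinearMap (incl o μ) := rfl

theorem dualEquiv_freeQuotient (f : Lip0 (OrbitClosures.mk G o)) (μ : FreeSpace o) :
    dualEquiv _ f (freeQuotient G o μ) = dualEquiv o (lipPullback G o f) μ := rfl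

theorem freeQuotient_δ (m : M) :
    freeQuotient G o (δ o m) = δ (OrbitClosures.mk G o) (OrbitClosures.mk G m) := rfl

theorem norm_freeQuotient_apply_le (μ : FreeSpace o) : ‖freeQuotient G o μ‖ ≤ ‖μ‖ := by
  rw [← (incl _).norm_map, incl_freeQuotient, ← (incl o).norm_map μ]
  exact (ContinuousLinearMap.le_of_opNorm_le _
    ((norm_adjointOp_le _).trans (lipPullback G o).norm_toContinuousLinearMap_le) _).trans
      (one_mul _).le

theorem denseRange_freeQuotient : DenseRange (freeQuotient G o) := by
  refine (dense_span_δ (OrbitClosures.mk G o)).mono ?_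
  have : Submodule.span ℝ (Set.range (δ (OrbitClosures.mk G o))) ≤
      (freeQuotient G o).range := by
    rw [Submodule.span_le]
    rintro _ ⟨A, rfl⟩
    obtain ⟨x, rfl⟩ := OrbitClosures.mk_surjective A
    exact ⟨δ o x, freeQuotient_δ o x⟩
  exact this

/-- Functionals annihilating the orbit differences are invariant functions, hence pullbacks of
functions on the orbit closures with the same norm; these bound the norm of the image from below. -/
theorem norm_freeQuotient_eq (x : FreeSpace o) : ‖freeQuotient G o x‖ =
    ‖(Submodule.Quotient.mk x : FreeSpace o ⧸ orbitDifferences G o)‖ := by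
  refine norm_apply_eq_norm_mk _ _ (norm_freeQuotient_apply_le o) (fun z hz =>
    apply_eq_zero_of_mem_orbitDifferences o _ (fun x g => by
      rw [freeQuotient_δ, freeQuotient_δ, OrbitClosures.mk_smul]) hz) (fun φ hφ h0 x => ?_) x
  obtain ⟨f, hf, rfl⟩ := exists_invariantLip_of_vanishing o φ h0
  obtain ⟨f, rfl⟩ : f ∈ Set.range (lipPullback G o) := by rwa [range_lipPullback]
  rw [LinearIsometryEquiv.norm_map, LinearIsometry.norm_map] at hφ
  rw [← dualEquiv_freeQuotient]
  refine (le_abs_self _).trans (((dualEquiv _ f).le_of_opNorm_le ?_ _).trans (one_mul _).le)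
  rwa [LinearIsometryEquiv.norm_map]

end Quotient

/-! ### Elementary properties of means -/

section Mean

variable {G : Type u}

/-- `m` is a mean on `D` for the pointwise order. -/
structure IsMean (D : Submodule ℝ (G → ℝ)) (m : D →ₗ[ℝ] ℝ) : Prop where
  map_one : ∀ f : D, (∀ h, (f : G → ℝ) h = 1) → m f = 1
  nonneg : ∀ f : D, (∀ h, 0 ≤ (f : G → ℝ) h) → 0 ≤ m f

variable {D : Submodule ℝ (G → ℝ)} {m : D →ₗ[ℝ] ℝ}

theorem IsMean.map_const (hm : IsMean D m) (h1 : (fun _ => 1 : G → ℝ) ∈ D) (f : D) (c : ℝ)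
    (hf : ∀ h, (f : G → ℝ) h = c) : m f = c := by
  have : f = c • (⟨_, h1⟩ : D) := Subtype.ext (funext fun h => by simp [hf])
  rw [this, map_smul, hm.map_one _ fun _ => rfl, smul_eq_mul, mul_one]

theorem IsMean.mono (hm : IsMean D m) (f g : D) (h : ∀ x, (f : G → ℝ) x ≤ (g : G → ℝ) x) :
    m f ≤ m g := by
  rw [← sub_nonneg, ← map_sub]
  exact hm.nonneg _ fun x => sub_nonneg.2 (h x)

theorem IsMean.abs_apply_le (hm : IsMean D m) (h1 : (fun _ => 1 : G → ℝ) ∈ D) (f : D) {C : ℝ}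
    (hf : ∀ h, |(f : G → ℝ) h| ≤ C) : |m f| ≤ C := by
  have hc : ∀ c : ℝ, (fun _ => c : G → ℝ) ∈ D := fun c => by
    convert D.smul_mem c h1 using 1
    funext x
    simp
  refine abs_le.2 ⟨?_, ?_⟩
  · rw [← hm.map_const h1 ⟨_, hc (-C)⟩ (-C) fun _ => rfl]
    exact hm.mono _ _ fun x => (abs_le.1 (hf x)).1
  · rw [← hm.map_const h1 ⟨_, hc C⟩ C fun _ => rfl]
    exact hm.mono _ _ fun x => (abs_le.1 (hf x)).2

theorem const_mem_Cbru [Group G] [TopologicalSpace G] (c : ℝ) : (fun _ => c : G → ℝ) ∈ Cbru G :=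
  ⟨⟨|c|, fun _ => le_rfl⟩, fun x => by
    rw [Metric.tendstoUniformly_iff]
    intro ε hε
    simp [hε]⟩

end Mean

/-- On δ(m) the value is f(gm) - f(g0), and invariance turns this into f(m) - f(0) = f(m). -/
theorem apply_linearAct_of_invariantLip {G : Type u} [Group G] {M : Type v} [MetricSpace M]
    [MulAction G M] [IsIsometricSMul G M] (o : M) {f : Lip0 o} (hf : f ∈ invariantLip G o) (g : G)
    (x : FreeSpace o) : dualEquiv o f (linearAct o g x) = dualEquiv o f x := by
  have : (dualEquiv o f).comp (linearAct o g) = dualEquiv o f := by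
    refine ContinuousLinearMap.ext_on (dense_span_δ o) ?_
    rintro _ ⟨m, rfl⟩
    change dualEquiv o f (linearAct o g (δ o m)) = _
    rw [linearAct_δ, map_sub, dualEquiv_δ, dualEquiv_δ, dualEquiv_δ, ← hf g, ← hf g, Lip0.apply_base,
      sub_zero]
  exact congrArg (fun T => T x) this

/-! ### The averaging operator and its dual projection -/

section Averaging

variable {G : Type u} [Group G] [TopologicalSpace G]
  {M : Type v} [MetricSpace M] [MulAction G M] [IsIsometricSMul G M] [ContinuousSMul G M] (o : M)
  {D : Submodule ℝ (G → ℝ)} {m : D →ₗ[ℝ] ℝ}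

/-- The averaging operator `R x φ = m (g ↦ φ (T_g x))`. -/
noncomputable def averagingOp (hD : Cbru G ≤ D) (hm : IsMean D m) :
    FreeSpace o →L[ℝ] StrongDual ℝ (StrongDual ℝ (FreeSpace o)) :=
  LinearMap.mkContinuous₂
    (LinearMap.mk₂ ℝ (fun x φ => m ⟨fun g => φ (linearAct o g x),
        hD (apply_linearAct_mem_Cbru o φ x)⟩)
      (fun x y φ => by
        rw [← map_add]
        exact congrArg m (Subtype.ext (funext fun g => by simp)))
      (fun c x φ => by
        rw [← map_smul]
        exact congrArg m (Subtype.ext (funext fun g => by simp)))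
      (fun x φ ψ => by
        rw [← map_add]
        rfl)
      (fun c x φ => by
        rw [← map_smul]
        rfl))
    1 fun x φ => by
      rw [one_mul, mul_comm]
      exact hm.abs_apply_le (hD (const_mem_Cbru 1)) _ fun g => (φ.le_opNorm _).trans
        (mul_le_mul_of_nonneg_left (norm_linearAct_apply_le o g x) (norm_nonneg _))

theorem averagingOp_apply (hD : Cbru G ≤ D) (hm : IsMean D m) (x : FreeSpace o)
    (φ : StrongDual ℝ (FreeSpace o)) : averagingOp o hD hm x φ =
      m ⟨fun g => φ (linearAct o g x), hD (apply_linearAct_mem_Cbru o φ x)⟩ := rfl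

theorem dualProjection_averagingOp_apply (hD : Cbru G ≤ D) (hm : IsMean D m)
    (φ : StrongDual ℝ (FreeSpace o)) (x : FreeSpace o) :
    dualProjection (averagingOp o hD hm) φ x = averagingOp o hD hm x φ := rfl

theorem norm_averagingOp_le (hD : Cbru G ≤ D) (hm : IsMean D m) : ‖averagingOp o hD hm‖ ≤ 1 :=
  LinearMap.mkContinuous₂_norm_le _ zero_le_one _

theorem averagingOp_apply_of_invariantLip (hD : Cbru G ≤ D) (hm : IsMean D m) {f : Lip0 o}
    (hf : f ∈ invariantLip G o) (x : FreeSpace o) :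
    averagingOp o hD hm x (dualEquiv o f) = dualEquiv o f x :=
  hm.map_const (hD (const_mem_Cbru 1)) _ _ fun g => apply_linearAct_of_invariantLip o hf g x

theorem averagingOp_apply_of_mem_invariantVectors (hD : Cbru G ≤ D) (hm : IsMean D m)
    {x : FreeSpace o} (hx : x ∈ invariantVectors G o) (φ : StrongDual ℝ (FreeSpace o)) :
    averagingOp o hD hm x φ = φ x :=
  hm.map_const (hD (const_mem_Cbru 1)) _ _ fun g => by
    change φ (linearAct o g x) = φ x
    rw [hx g]

theorem dualProjection_averagingOp_of_invariantLip (hD : Cbru G ≤ D) (hm : IsMean D m) {f : Lip0 o}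
    (hf : f ∈ invariantLip G o) :
    dualProjection (averagingOp o hD hm) (dualEquiv o f) = dualEquiv o f :=
  ContinuousLinearMap.ext fun x => averagingOp_apply_of_invariantLip o hD hm hf x

variable (hbdd : ∀ x : M, Bornology.IsBounded (MulAction.orbit G x))
  (hright : ∀ (g : G) (f f' : D), (∀ h, (f' : G → ℝ) h = (f : G → ℝ) (h * g⁻¹)) → m f' = m f)

include hbdd hright

/-- Bounded orbits make k ↦ f(ky) and k ↦ f(k0) separately admissible, so the mean of their
difference splits. Replacing y by gy right-translates the first function and leaves the second
alone. -/
theorem averagingOp_δ_smul (hD : Cbru G ≤ D) (hm : IsMean D m) (x : M) (g : G) :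
    averagingOp o hD hm (δ o (g • x)) = averagingOp o hD hm (δ o x) := by
  refine ContinuousLinearMap.ext fun φ => ?_
  obtain ⟨f, rfl⟩ := (dualEquiv o).surjective φ
  have key : ∀ y : M, averagingOp o hD hm (δ o y) (dualEquiv o f) =
      m ⟨fun g => f (g • y), hD (comp_smul_mem_Cbru o f y (hbdd y))⟩ -
      m ⟨fun g => f (g • o), hD (comp_smul_mem_Cbru o f o (hbdd o))⟩ := fun y => by
    rw [averagingOp_apply, ← map_sub]
    refine congrArg m (Subtype.ext (funext fun k => ?_))
    change dualEquiv o f (linearAct o k (δ o y)) = f (k • y) - f (k • o)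
    rw [linearAct_δ, map_sub, dualEquiv_δ, dualEquiv_δ]
  rw [key, key, hright g⁻¹ ⟨fun g => f (g • x), hD (comp_smul_mem_Cbru o f x (hbdd x))⟩ _
    fun h => by simp [mul_smul]]

theorem exists_invariantLip_dualProjection (hD : Cbru G ≤ D) (hm : IsMean D m)
    (φ : StrongDual ℝ (FreeSpace o)) :
    ∃ f ∈ invariantLip G o, dualEquiv o f = dualProjection (averagingOp o hD hm) φ :=
  exists_invariantLip_of_vanishing o _ fun z hz => by
    rw [dualProjection_averagingOp_apply, apply_eq_zero_of_mem_orbitDifferences o _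
      (averagingOp_δ_smul o hbdd hright hD hm) hz, zero_apply]

theorem isIdempotentElem_dualProjection_averagingOp (hD : Cbru G ≤ D) (hm : IsMean D m) :
    IsIdempotentElem (dualProjection (averagingOp o hD hm)) := by
  refine ContinuousLinearMap.ext fun φ => ?_
  obtain ⟨f, hf, hfφ⟩ := exists_invariantLip_dualProjection o hbdd hright hD hm φ
  change dualProjection _ (dualProjection _ φ) = _
  rw [← hfφ, dualProjection_averagingOp_of_invariantLip o hD hm hf]

theorem range_dualProjection_averagingOp (hD : Cbru G ≤ D) (hm : IsMean D m) :
    Set.range (dualProjection (averagingOp o hD hm)) =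
      dualEquiv o '' (invariantLip G o : Set (Lip0 o)) := by
  refine Set.Subset.antisymm ?_ ?_
  · rintro _ ⟨φ, rfl⟩
    exact exists_invariantLip_dualProjection o hbdd hright hD hm φ
  · rintro _ ⟨f, hf, rfl⟩
    exact ⟨_, dualProjection_averagingOp_of_invariantLip o hD hm hf⟩

/-- The lower bound holds because averaging returns f(x) when f is invariant, and such f are all the
functionals annihilating the orbit differences. -/
theorem norm_averagingOp_eq (hD : Cbru G ≤ D) (hm : IsMean D m) (x : FreeSpace o) :
    ‖averagingOp o hD hm x‖ =
      ‖(Submodule.Quotient.mk x : FreeSpace o ⧸ orbitDifferences G o)‖ := by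
  refine norm_apply_eq_norm_mk _ _ (fun x =>
    (ContinuousLinearMap.le_of_opNorm_le _ (norm_averagingOp_le o hD hm) x).trans (one_mul _).le)
    (fun z hz => apply_eq_zero_of_mem_orbitDifferences o _
      (averagingOp_δ_smul o hbdd hright hD hm) hz) (fun φ hφ h0 x => ?_) x
  obtain ⟨f, hf, rfl⟩ := exists_invariantLip_of_vanishing o φ h0
  rw [← averagingOp_apply_of_invariantLip o hD hm hf]
  exact (le_abs_self _).trans (((averagingOp o hD hm x).le_opNorm _).trans
    (mul_le_of_le_one_right (norm_nonneg _) hφ))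

theorem exists_projection_lip (hD : Cbru G ≤ D) (hm : IsMean D m) :
    ∃ (J : Lip0 (OrbitClosures.mk G o) →ₗᵢ[ℝ] Lip0 o) (P : Lip0 o →L[ℝ] Lip0 o),
      IsIdempotentElem P ∧ ‖P‖ ≤ 1 ∧ Set.range P = Set.range J := by
  let e := dualEquiv o
  let P : Lip0 o →L[ℝ] Lip0 o := e.symm.toContinuousLinearEquiv.toContinuousLinearMap.comp
    ((dualProjection (averagingOp o hD hm)).comp e.toContinuousLinearEquiv.toContinuousLinearMap)
  have hP : ∀ f, P f = e.symm (dualProjection (averagingOp o hD hm) (e f)) := fun _ => rfl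
  have hmem : ∀ f, P f ∈ invariantLip G o := fun f => by
    obtain ⟨k, hk, hkφ⟩ := exists_invariantLip_dualProjection o hbdd hright hD hm (e f)
    rw [hP, ← hkφ, e.symm_apply_apply]
    exact hk
  have hid : ∀ f ∈ invariantLip G o, P f = f := fun f hf => by
    rw [hP, dualProjection_averagingOp_of_invariantLip o hD hm hf, e.symm_apply_apply]
  refine ⟨lipPullback G o, P, ContinuousLinearMap.ext fun f => hid _ (hmem f),
    ContinuousLinearMap.opNorm_le_bound _ zero_le_one fun f => ?_, ?_⟩
  · rw [hP, e.symm.norm_map, one_mul, ← e.norm_map f]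
    refine ContinuousLinearMap.opNorm_le_bound _ (norm_nonneg _) fun x => ?_
    rw [dualProjection_averagingOp_apply, mul_comm]
    refine (ContinuousLinearMap.le_opNorm _ _).trans
      (mul_le_mul_of_nonneg_right ?_ (norm_nonneg _))
    exact (ContinuousLinearMap.le_of_opNorm_le _ (norm_averagingOp_le o hD hm) x).trans
      (one_mul _).le
  · rw [range_lipPullback]
    refine Set.Subset.antisymm ?_ fun f hf => ⟨f, hid f hf⟩
    rintro _ ⟨f, rfl⟩
    exact hmem f

/-- On fixed vectors averaging is the isometric canonical embedding, so there the quotient norm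
equals the norm. The hypothesis `h` says that no nonzero functional kills both the orbit differences
and the fixed vectors. -/
theorem exists_projection_invariantVectors (hD : Cbru G ≤ D) (hm : IsMean D m)
    (h : invariantLip G o ⊓ annihilator (invariantVectors G o : Set (FreeSpace o)) = ⊥) :
    ∃ P : FreeSpace o →L[ℝ] FreeSpace o, IsIdempotentElem P ∧ ‖P‖ ≤ 1 ∧
      Set.range P = (invariantVectors G o : Set (FreeSpace o)) := by
  refine exists_projection_of_norm_mk_eq (orbitDifferences G o) _ (isClosed_invariantVectors o)
    (fun x hx => ?_) fun φ hN hI => ?_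
  · rw [← norm_averagingOp_eq o hbdd hright hD hm]
    have : averagingOp o hD hm x = NormedSpace.inclusionInDoubleDual ℝ (FreeSpace o) x :=
      ContinuousLinearMap.ext fun φ => averagingOp_apply_of_mem_invariantVectors o hD hm hx φ
    rw [this]
    exact (NormedSpace.inclusionInDoubleDualLi ℝ).norm_map x
  · obtain ⟨f, hf, rfl⟩ := exists_invariantLip_of_vanishing o φ hN
    have : f ∈ invariantLip G o ⊓ annihilator (invariantVectors G o : Set (FreeSpace o)) :=
      ⟨hf, hI⟩
    rw [h, Submodule.mem_bot] at this
    rw [this, map_zero]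

end Averaging

theorem IsLeftInvariantMean.isMean {G : Type u} [Group G] {D : Submodule ℝ (G → ℝ)} {m : D →ₗ[ℝ] ℝ}
    (hm : IsLeftInvariantMean D m) : IsMean D m := ⟨hm.map_one, hm.nonneg⟩

/-! ### Uniformly continuous functions and composition of means -/

section UniformlyContinuous

variable {G : Type u} [Group G] [TopologicalSpace G]

theorem const_mem_Cblu (c : ℝ) : (fun _ => c : G → ℝ) ∈ Cblu G :=
  ⟨⟨|c|, fun _ => le_rfl⟩, fun x => by
    rw [Metric.tendstoUniformly_iff]
    intro ε hε
    simp [hε]⟩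

theorem continuous_of_mem_Cblu {f : G → ℝ} (hf : f ∈ Cblu G) : Continuous f :=
  continuous_iff_continuousAt.2 fun x => by
    simpa [ContinuousAt] using (hf.2 x).tendsto_at 1

theorem continuous_of_mem_Cbru {f : G → ℝ} (hf : f ∈ Cbru G) : Continuous f :=
  continuous_iff_continuousAt.2 fun x => by
    simpa [ContinuousAt] using (hf.2 x).tendsto_at 1

variable [IsTopologicalGroup G]

theorem comp_mul_left_mem_Cblu {f : G → ℝ} (hf : f ∈ Cblu G) (g : G) :
    (fun h => f (g * h)) ∈ Cblu G := by
  obtain ⟨C, hC⟩ := hf.1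
  refine ⟨⟨C, fun h => hC _⟩, fun x => ?_⟩
  simp only [← mul_assoc]
  intro s hs
  exact ((continuous_const_mul g).tendsto x).eventually (hf.2 (g * x) s hs)

theorem comp_inv_mem_Cblu {f : G → ℝ} (hf : f ∈ Cbru G) : (fun h => f h⁻¹) ∈ Cblu G := by
  obtain ⟨C, hC⟩ := hf.1
  refine ⟨⟨C, fun h => hC _⟩, fun x => ?_⟩
  simp only [mul_inv_rev]
  intro s hs
  have := (continuous_inv.tendsto x).eventually (hf.2 x⁻¹ s hs)
  exact this.mono fun y hy h => hy h⁻¹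

/-- The inner average in the composition of two means. -/
theorem mean_translates_mem_Cblu {m : Cblu G →ₗ[ℝ] ℝ} (hm : IsMean (Cblu G) m) (f : Cblu G) :
    (fun g => m ⟨fun h => (f : G → ℝ) (g * h), comp_mul_left_mem_Cblu f.2 g⟩) ∈ Cblu G := by
  obtain ⟨C, hC⟩ := f.2.1
  refine ⟨⟨C, fun g => hm.abs_apply_le (const_mem_Cblu 1) _ fun h => hC _⟩, fun x => ?_⟩
  rw [Metric.tendstoUniformly_iff]
  intro ε hε
  filter_upwards [Metric.tendstoUniformly_iff.1 (f.2.2 x) (ε / 2) (half_pos hε)] with y hy h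
  refine lt_of_le_of_lt ?_ (half_lt_self hε)
  rw [Real.dist_eq, ← map_sub]
  refine hm.abs_apply_le (const_mem_Cblu 1) _ fun k => ?_
  have := (hy (h * k)).le
  rwa [Real.dist_eq, ← mul_assoc, ← mul_assoc] at this

/-- Composing a left-invariant and a right-invariant mean gives a bi-invariant mean. -/
theorem exists_biInvariant_mean_Cblu {m m' : Cblu G →ₗ[ℝ] ℝ}
    (hm : IsLeftInvariantMean (Cblu G) m) (hm' : IsMean (Cblu G) m')
    (hright : ∀ (g : G) (f f' : Cblu G),
      (∀ h, (f' : G → ℝ) h = (f : G → ℝ) (h * g⁻¹)) → m' f' = m' f) :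
    ∃ n : Cblu G →ₗ[ℝ] ℝ, IsLeftInvariantMean (Cblu G) n ∧ ∀ (g : G) (f f' : Cblu G),
      (∀ h, (f' : G → ℝ) h = (f : G → ℝ) (h * g⁻¹)) → n f' = n f := by
  -- The mean is n(f) = m(g ↦ m'(h ↦ f(gh))): left translations of f act on the outer variable,
  -- right translations on the inner one.
  refine ⟨{ toFun := fun f => m ⟨_, mean_translates_mem_Cblu hm' f⟩
            map_add' := fun f k => ?_, map_smul' := fun c f => ?_ }, ⟨fun f hf => ?_, fun f hf => ?_,
            fun g f f' h => ?_⟩, fun g f f' h => ?_⟩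
  · rw [← map_add]
    refine congrArg m (Subtype.ext (funext fun g => ?_))
    exact m'.map_add ⟨_, comp_mul_left_mem_Cblu f.2 g⟩ ⟨_, comp_mul_left_mem_Cblu k.2 g⟩
  · rw [RingHom.id_apply, ← map_smul]
    refine congrArg m (Subtype.ext (funext fun g => ?_))
    exact m'.map_smul c ⟨_, comp_mul_left_mem_Cblu f.2 g⟩
  · exact hm.map_one _ fun g => hm'.map_one _ fun h => hf _
  · exact hm.nonneg _ fun g => hm'.nonneg _ fun h => hf _
  · refine hm.left_inv g _ _ fun k => ?_
    refine congrArg m' (Subtype.ext (funext fun l => ?_))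
    change (f' : G → ℝ) (k * l) = (f : G → ℝ) (g⁻¹ * k * l)
    rw [h, mul_assoc]
  · refine congrArg m (Subtype.ext (funext fun k => ?_))
    refine hright g _ _ fun l => ?_
    change (f' : G → ℝ) (k * l) = (f : G → ℝ) (k * (l * g⁻¹))
    rw [h, mul_assoc]

end UniformlyContinuous

theorem IsSIN.exists_conj_invariant {G : Type u} [Group G] [TopologicalSpace G] (hG : IsSIN G) {s : Set G} (hs : s ∈ 𝓝 (1 : G)) :
    ∃ V ∈ 𝓝 (1 : G), V ⊆ s ∧ ∀ g : G, ∀ v ∈ V, g * v * g⁻¹ ∈ V := by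
  obtain ⟨V, hV, hVs, hconj⟩ := hG s hs
  exact ⟨V, hV, hVs, fun g v hv => by rw [← hconj g]; exact ⟨v, hv, rfl⟩⟩

/-! ### Bi-invariant means on SIN groups -/

section SIN

variable {G : Type u} [Group G] [TopologicalSpace G] [IsTopologicalGroup G]

/-- Write hy = v(hx) with v = h(yx⁻¹)h⁻¹. An invariant neighbourhood containing yx⁻¹ contains v for
every h, so left uniform continuity at 1 suffices. -/
theorem IsSIN.Cblu_le_Cbru (hG : IsSIN G) : Cblu G ≤ Cbru G := fun f hf => by
  refine ⟨hf.1, fun x => ?_⟩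
  rw [Metric.tendstoUniformly_iff]
  intro ε hε
  obtain ⟨V, hV, hVs, hconj⟩ := hG.exists_conj_invariant
    (Metric.tendstoUniformly_iff.1 (hf.2 1) ε hε)
  have hc : Filter.Tendsto (fun y : G => y * x⁻¹) (𝓝 x) (𝓝 1) := by
    simpa using (continuous_mul_const x⁻¹).tendsto x
  filter_upwards [hc hV] with y hy h
  have := hVs (hconj h _ hy) (h * x)
  simpa [mul_assoc] using this

theorem IsSIN.Cbru_le_Cblu (hG : IsSIN G) : Cbru G ≤ Cblu G := fun f hf => by
  refine ⟨hf.1, fun x => ?_⟩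
  rw [Metric.tendstoUniformly_iff]
  intro ε hε
  obtain ⟨V, hV, hVs, hconj⟩ := hG.exists_conj_invariant
    (Metric.tendstoUniformly_iff.1 (hf.2 1) ε hε)
  have hc : Filter.Tendsto (fun y : G => x⁻¹ * y) (𝓝 x) (𝓝 1) := by
    simpa using (continuous_const_mul x⁻¹).tendsto x
  filter_upwards [hc hV] with y hy h
  have := hVs (hconj h⁻¹ _ hy) (x * h)
  simpa [mul_assoc] using this

theorem IsSIN.Cbu_eq (hG : IsSIN G) : Cbu G = Cblu G :=
  inf_eq_left.2 hG.Cblu_le_Cbru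

theorem IsSIN.exists_isBiInvariantMean (hG : IsSIN G) (hA : IsAmenable G) :
    ∃ m : Cbu G →ₗ[ℝ] ℝ, IsBiInvariantMean ⊤ (Cbu G) m := by
  obtain ⟨m, hm⟩ := hA
  rw [hG.Cbu_eq]
  -- The inner mean is `m` composed with inversion, which exchanges left and right translations.
  obtain ⟨n, hn, hnr⟩ := exists_biInvariant_mean_Cblu (m' :=
    { toFun := fun f => m ⟨_, comp_inv_mem_Cblu (hG.Cblu_le_Cbru f.2)⟩
      map_add' := fun f k => by rw [← map_add]; rfl
      map_smul' := fun c f => by rw [RingHom.id_apply, ← map_smul]; rfl }) hm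
    ⟨fun f hf => hm.map_one _ fun _ => hf _, fun f hf => hm.nonneg _ fun _ => hf _⟩
    (fun g f f' h => hm.left_inv g⁻¹ _ _ fun k => by
      change (f' : G → ℝ) k⁻¹ = (f : G → ℝ) (g⁻¹⁻¹ * k)⁻¹
      rw [h, mul_inv_rev, inv_inv])
  exact ⟨n, hn.map_one, fun f hf => hn.nonneg f (Filter.eventually_top.1 hf), hn.left_inv, hnr⟩

end SIN

section LocallyCompact

open Measure CompactlySupported

/-! ### The modular function -/

section Modular

variable {G : Type u} [Group G] [TopologicalSpace G] [IsTopologicalGroup G] [LocallyCompactSpace G]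
  [MeasurableSpace G] [BorelSpace G] (μ : Measure G) [μ.IsHaarMeasure] [μ.Regular]

omit [IsTopologicalGroup G] [LocallyCompactSpace G] [μ.Regular] in
/-- The integral of a kernel whose sections have locally uniformly compact support. -/
theorem continuous_integral_of_compact_support {X : Type*} [TopologicalSpace X]
    [LocallyCompactSpace X] {F : X → G → ℝ} (hF : Continuous F.uncurry)
    (hs : ∀ t : Set X, IsCompact t → ∃ k : Set G, IsCompact k ∧ ∀ x ∈ t, ∀ y ∉ k, F x y = 0) :
    Continuous fun x => ∫ y, F x y ∂μ := by
  refine continuous_iff_continuousAt.2 fun x => ?_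
  obtain ⟨t, ht, hx⟩ := exists_compact_mem_nhds x
  obtain ⟨k, hk, h0⟩ := hs t ht
  exact (continuousOn_integral_of_compact_support hk hF.continuousOn
    fun p y hp hy => h0 p hp y hy).continuousAt hx

theorem map_mul_right_eq_modularCharacterFun_smul (g : G) :
    μ.map (· * g) = modularCharacterFun g • μ := by
  rw [modularCharacterFun_eq_haarScalarFactor μ g]
  have : (μ.map (· * g)).Regular := Regular.map (Homeomorph.mulRight g)
  exact isMulLeftInvariant_eq_smul_of_regular _ μ

theorem integral_mul_right_eq_modularCharacterFun_mul (f : G → ℝ) (g : G) :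
    ∫ y, f (y * g) ∂μ = modularCharacterFun g * ∫ y, f y ∂μ := by
  have h := (Homeomorph.mulRight g).measurableEmbedding.integral_map (μ := μ) f
  change ∫ y, f y ∂(μ.map (· * g)) = ∫ y, f (y * g) ∂μ at h
  rw [← h, map_mul_right_eq_modularCharacterFun_smul, integral_smul_nnreal_measure]
  rfl

/-- Right translations only rescale the left Haar measure, so almost everywhere bounds survive them.
-/
theorem quasiMeasurePreserving_mul_right (g : G) :
    Measure.QuasiMeasurePreserving (fun y => y * g) μ μ := by
  refine ⟨(continuous_mul_const g).measurable, ?_⟩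
  rw [map_mul_right_eq_modularCharacterFun_smul]
  exact Measure.smul_absolutelyContinuous

-- The modular function is the quotient of ∫ f(yg) dy by ∫ f for a bump function f, and the
-- numerator depends continuously on g.
open scoped Pointwise in
theorem continuous_modularCharacterFun : Continuous (modularCharacterFun : G → ℝ≥0) := by
  let μ : Measure G := haar
  obtain ⟨⟨f, hf⟩, hfs, hf0, hf1⟩ : ∃ f : C(G, ℝ), HasCompactSupport f ∧ 0 ≤ f ∧ f 1 ≠ 0 :=
    exists_continuous_nonneg_pos 1
  have hpos : 0 < ∫ y, f y ∂μ := hf.integral_pos_of_hasCompactSupport_nonneg_nonzero hfs hf0 hf1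
  refine NNReal.isEmbedding_coe.continuous_iff.2 ?_
  have : ((↑) ∘ modularCharacterFun : G → ℝ) =
      fun g => (∫ y, f (y * g) ∂μ) / ∫ y, f y ∂μ := by
    funext g
    rw [integral_mul_right_eq_modularCharacterFun_mul, mul_div_cancel_right₀ _ hpos.ne']
    rfl
  rw [this]
  refine (continuous_integral_of_compact_support μ (F := fun g y => f (y * g)) ?_
    fun t ht => ?_).div_const _
  · exact hf.comp (continuous_snd.mul continuous_fst)
  · refine ⟨tsupport f * t⁻¹, hfs.isCompact.mul ht.inv, fun x hx y hy => ?_⟩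
    by_contra hne
    exact hy ⟨y * x, subset_tsupport f hne, x⁻¹, Set.inv_mem_inv.2 hx, by simp⟩

end Modular

/-! ### Convolution and extension of means to L_∞ -/

section Smoothing

variable {G : Type u} [Group G] [TopologicalSpace G] [IsTopologicalGroup G] [LocallyCompactSpace G]
  [MeasurableSpace G] [BorelSpace G] (μ : Measure G) [μ.IsHaarMeasure] [μ.Regular]

/-- The kernel `y ↦ φ (y⁻¹) Δ(y)`. -/
noncomputable def smoothingKernel (φ : G → ℝ) (y : G) : ℝ := φ y⁻¹ * modularCharacterFun y

/-- The convolution of `φ` and `f`, written as an average of right translates of the argument. -/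
noncomputable def smoothing (φ f : G → ℝ) (x : G) : ℝ := ∫ y, smoothingKernel φ y * f (y * x) ∂μ

theorem continuous_smoothingKernel {φ : G → ℝ} (hφ : Continuous φ) :
    Continuous (smoothingKernel φ) :=
  (hφ.comp continuous_inv).mul (NNReal.continuous_coe.comp continuous_modularCharacterFun)

omit [MeasurableSpace G] [BorelSpace G] in
theorem hasCompactSupport_smoothingKernel {φ : G → ℝ} (hφ : HasCompactSupport φ) :
    HasCompactSupport (smoothingKernel φ) :=
  (hφ.comp_homeomorph (Homeomorph.inv G)).mul_right

omit [μ.Regular] in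
theorem integrable_smoothingKernel (φ : C_c(G, ℝ)) : Integrable (smoothingKernel φ) μ :=
  (continuous_smoothingKernel φ.continuous).integrable_of_hasCompactSupport
    (hasCompactSupport_smoothingKernel φ.hasCompactSupport)

variable {μ} in
omit [Group G] [TopologicalSpace G] [IsTopologicalGroup G] [LocallyCompactSpace G] [BorelSpace G]
   [μ.IsHaarMeasure] [μ.Regular] in
theorem exists_ae_bound_of_mem_Linf {f : G → ℝ} (hf : f ∈ Linf μ) :
    ∃ C : ℝ, 0 ≤ C ∧ ∀ᵐ y ∂μ, |f y| ≤ C := by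
  have hf' : MemLp f ∞ μ := hf
  refine ⟨(eLpNorm f ∞ μ).toReal, ENNReal.toReal_nonneg, ?_⟩
  filter_upwards [ae_le_eLpNormEssSup (f := f) (μ := μ)] with y hy
  rw [← eLpNorm_exponent_top] at hy
  simpa using ENNReal.toReal_mono hf'.2.ne hy

variable {μ}

theorem comp_mul_right_mem_Linf {f : G → ℝ} (hf : f ∈ Linf μ) (g : G) :
    (fun h => f (h * g)) ∈ Linf μ := by
  obtain ⟨C, -, hC⟩ := exists_ae_bound_of_mem_Linf hf
  exact memLp_top_of_bound (hf.1.comp_quasiMeasurePreserving (quasiMeasurePreserving_mul_right μ g))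
    C ((quasiMeasurePreserving_mul_right μ g).ae hC)

theorem integrable_smoothing (φ : C_c(G, ℝ)) {f : G → ℝ} (hf : f ∈ Linf μ) (x : G) :
    Integrable (fun y => smoothingKernel φ y * f (y * x)) μ := by
  have h := comp_mul_right_mem_Linf hf x
  obtain ⟨C, -, hC⟩ := exists_ae_bound_of_mem_Linf h
  exact (integrable_smoothingKernel μ φ).mul_bdd h.1 hC

theorem abs_smoothing_le (φ : C_c(G, ℝ)) {f : G → ℝ} {C : ℝ}
    (hC : ∀ᵐ y ∂μ, |f y| ≤ C) (x : G) :
    |smoothing μ φ f x| ≤ (∫ y, |smoothingKernel φ y| ∂μ) * C := by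
  rw [← integral_mul_const, ← Real.norm_eq_abs]
  refine norm_integral_le_of_norm_le ((integrable_smoothingKernel μ φ).abs.mul_const C) ?_
  filter_upwards [(quasiMeasurePreserving_mul_right μ x).ae hC] with y hy
  rw [Real.norm_eq_abs, abs_mul]
  exact mul_le_mul_of_nonneg_left hy (abs_nonneg _)

/-- Substituting y ↦ yg scales the integral by Δ(g), and the kernel produces the same factor, which
cancels. Left translations of the convolution thus move onto φ. -/
theorem smoothing_mul_left (φ f : G → ℝ) (g x : G) :
    smoothing μ φ f (g * x) = smoothing μ (fun y => φ (g * y)) f x := by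
  have h := integral_mul_right_eq_modularCharacterFun_mul μ
    (fun y => smoothingKernel (fun y => φ (g * y)) y * f (y * x)) g
  have h2 : ∀ y, smoothingKernel (fun y => φ (g * y)) (y * g) * f (y * g * x) =
      modularCharacterFun g * (smoothingKernel φ y * f (y * (g * x))) := fun y => by
    simp only [smoothingKernel, modularCharacterFun_map_mul, mul_inv_rev, mul_inv_cancel_left,
      NNReal.coe_mul, mul_assoc]
    ring
  simp only [h2] at h
  rw [integral_const_mul] at h
  exact mul_left_cancel₀ (NNReal.coe_ne_zero.2 (modularCharacterFun_pos g).ne') h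

omit [μ.Regular] in
theorem smoothing_comp_mul_left (φ f : G → ℝ) (g x : G) :
    smoothing μ φ (fun y => f (g⁻¹ * y)) x =
      smoothing μ (fun y => modularCharacterFun g * φ (y * g⁻¹)) f x := by
  unfold smoothing
  rw [← integral_mul_left_eq_self _ g]
  refine integral_congr_ae (Filter.Eventually.of_forall fun y => ?_)
  simp only [smoothingKernel, modularCharacterFun_map_mul, mul_inv_rev, NNReal.coe_mul, mul_assoc,
    inv_mul_cancel_left]
  ring

omit [BorelSpace G] [μ.IsHaarMeasure] [μ.Regular] in
theorem smoothing_comp_mul_right (φ f : G → ℝ) (g x : G) :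
    smoothing μ φ (fun y => f (y * g)) x = smoothing μ φ f (x * g) := by
  simp only [smoothing, mul_assoc]

theorem smoothing_add_right (φ : C_c(G, ℝ)) {f k : G → ℝ} (hf : f ∈ Linf μ) (hk : k ∈ Linf μ)
    (x : G) : smoothing μ φ (f + k) x = smoothing μ φ f x + smoothing μ φ k x := by
  unfold smoothing
  rw [← integral_add (integrable_smoothing φ hf x) (integrable_smoothing φ hk x)]
  simp only [Pi.add_apply, mul_add]

omit [BorelSpace G] [μ.IsHaarMeasure] [μ.Regular] in
theorem smoothing_smul_right (φ : G → ℝ) (c : ℝ) (f : G → ℝ) (x : G) :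
    smoothing μ φ (c • f) x = c * smoothing μ φ f x := by
  unfold smoothing
  rw [← integral_const_mul]
  simp only [Pi.smul_apply, smul_eq_mul, mul_left_comm]

theorem smoothing_add_left (φ ψ : C_c(G, ℝ)) {f : G → ℝ} (hf : f ∈ Linf μ) (x : G) :
    smoothing μ (φ + ψ : C_c(G, ℝ)) f x = smoothing μ φ f x + smoothing μ ψ f x := by
  unfold smoothing
  rw [← integral_add (integrable_smoothing φ hf x) (integrable_smoothing ψ hf x)]
  simp only [smoothingKernel, CompactlySupportedContinuousMap.coe_add, Pi.add_apply, add_mul]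

omit [BorelSpace G] [μ.IsHaarMeasure] [μ.Regular] in
theorem smoothing_smul_left (c : ℝ) (φ : C_c(G, ℝ)) (f : G → ℝ) (x : G) :
    smoothing μ (c • φ : C_c(G, ℝ)) f x = c * smoothing μ φ f x := by
  unfold smoothing
  rw [← integral_const_mul]
  simp only [smoothingKernel, CompactlySupportedContinuousMap.coe_smul, Pi.smul_apply, smul_eq_mul,
    mul_assoc]

theorem smoothing_nonneg {φ f : G → ℝ} (hφ : ∀ x, 0 ≤ φ x) (hf : ∀ᵐ y ∂μ, 0 ≤ f y) (x : G) :
    0 ≤ smoothing μ φ f x := by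
  refine integral_nonneg_of_ae ?_
  filter_upwards [(quasiMeasurePreserving_mul_right μ x).ae hf] with y hy
  exact mul_nonneg (mul_nonneg (hφ _) (NNReal.coe_nonneg _)) hy

/-- The left translate `y ↦ φ (g y)`. -/
def translateLeft (φ : C_c(G, ℝ)) (g : G) : C_c(G, ℝ) where
  toFun y := φ (g * y)
  continuous_toFun := φ.continuous.comp (continuous_const_mul g)
  hasCompactSupport' := φ.hasCompactSupport.comp_homeomorph (Homeomorph.mulLeft g)

/-- The right translate `y ↦ φ (y g)`. -/
def translateRight (φ : C_c(G, ℝ)) (g : G) : C_c(G, ℝ) where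
  toFun y := φ (y * g)
  continuous_toFun := φ.continuous.comp (continuous_mul_const g)
  hasCompactSupport' := φ.hasCompactSupport.comp_homeomorph (Homeomorph.mulRight g)

open scoped Pointwise in
theorem smoothing_mem_Cblu (φ : C_c(G, ℝ)) {f : G → ℝ} (hf : f ∈ Linf μ) :
    smoothing μ φ f ∈ Cblu G := by
  obtain ⟨C, hC0, hC⟩ := exists_ae_bound_of_mem_Linf hf
  refine ⟨⟨_, abs_smoothing_le φ hC⟩, fun x => ?_⟩
  rw [Metric.tendstoUniformly_iff]
  intro ε hε
  -- The integral of `F z` bounds the uniform distance between the translates by `x` and `z`, and it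
  -- tends to 0 as z → x.
  let F : G → G → ℝ := fun z y =>
    |smoothingKernel (translateLeft φ x) y - smoothingKernel (translateLeft φ z) y| * C
  have hF : Continuous fun z => ∫ y, F z y ∂μ := by
    have hK : Continuous fun p : G × G => smoothingKernel (translateLeft φ p.1) p.2 :=
      (φ.continuous.comp (continuous_fst.mul continuous_snd.inv)).mul
        (NNReal.continuous_coe.comp (continuous_modularCharacterFun.comp continuous_snd))
    refine continuous_integral_of_compact_support μ ?_ fun t ht => ?_
    · exact ((hK.comp (continuous_const.prodMk continuous_snd)).sub hK).abs.mul continuous_const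
    -- The point `x` is inserted because `F z` also involves the kernel translated by `x`.
    · have h0 : ∀ z ∈ insert x t, ∀ y ∉ (tsupport φ)⁻¹ * insert x t,
          smoothingKernel (translateLeft φ z) y = 0 := fun z hz y hy => by
        refine mul_eq_zero_of_left ?_ _
        change φ (z * y⁻¹) = 0
        by_contra hne
        exact hy ⟨(z * y⁻¹)⁻¹, Set.inv_mem_inv.2 (subset_tsupport _ hne), z, hz, by simp⟩
      refine ⟨(tsupport φ)⁻¹ * insert x t,
        φ.hasCompactSupport.isCompact.inv.mul (ht.insert x), fun z hz y hy => ?_⟩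
      simp only [F, h0 z (Set.mem_insert_of_mem _ hz) y hy, h0 x (Set.mem_insert _ _) y hy,
        sub_self, abs_zero, zero_mul]
  have hF0 : ∫ y, F x y ∂μ = 0 := by simp [F]
  have := hF.tendsto x
  rw [hF0] at this
  filter_upwards [this.eventually_lt_const hε] with z hz h
  refine lt_of_le_of_lt ?_ hz
  rw [Real.dist_eq, smoothing_mul_left, smoothing_mul_left]
  have hsub := smoothing_add_left (translateLeft φ x) ((-1 : ℝ) • translateLeft φ z) hf h
  rw [smoothing_smul_left, neg_one_mul, ← sub_eq_add_neg] at hsub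
  change |smoothing μ (translateLeft φ x) f h - smoothing μ (translateLeft φ z) f h| ≤ _
  rw [← hsub]
  refine (abs_smoothing_le _ hC h).trans (le_of_eq ?_)
  rw [← integral_mul_const]
  refine integral_congr_ae (Filter.Eventually.of_forall fun y => ?_)
  simp only [F, smoothingKernel, CompactlySupportedContinuousMap.coe_add, Pi.add_apply,
    CompactlySupportedContinuousMap.coe_smul, Pi.smul_apply, smul_eq_mul]
  congr 2
  ring

omit [μ.Regular] in
/-- Uniqueness of the Haar measure, for positive functionals. -/
theorem exists_eq_mul_integral_of_translateLeft [T2Space G] (Λ : C_c(G, ℝ) →ₗ[ℝ] ℝ)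
    (hpos : ∀ φ : C_c(G, ℝ), (∀ x, 0 ≤ φ x) → 0 ≤ Λ φ)
    (hinv : ∀ (φ : C_c(G, ℝ)) (g : G), Λ (translateLeft φ g) = Λ φ) :
    ∃ c : ℝ, ∀ φ : C_c(G, ℝ), Λ φ = c * ∫ x, φ x ∂μ := by
  let L : C_c(G, ℝ) →ₚ[ℝ] ℝ := PositiveLinearMap.mk₀ Λ fun φ hφ => hpos φ hφ
  have hL : ∀ φ : C_c(G, ℝ), ∫ x, φ x ∂(RealRMK.rieszMeasure L) = Λ φ :=
    RealRMK.integral_rieszMeasure L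
  have hli : (RealRMK.rieszMeasure L).IsMulLeftInvariant := by
    refine ⟨fun g => ?_⟩
    have : ((RealRMK.rieszMeasure L).map (g * ·)).Regular := Regular.map (Homeomorph.mulLeft g)
    refine ext_of_integral_eq_on_compactlySupported fun φ => ?_
    have h := (Homeomorph.mulLeft g).measurableEmbedding.integral_map
      (μ := RealRMK.rieszMeasure L) φ
    rw [hL, ← hinv φ g, ← hL]
    exact h
  obtain ⟨c, hc⟩ := exists_integral_isMulLeftInvariant_eq_smul_of_hasCompactSupport
    (RealRMK.rieszMeasure L) μ
  refine ⟨c, fun φ => ?_⟩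
  rw [← hL, hc φ φ.continuous φ.hasCompactSupport, integral_smul_nnreal_measure]
  rfl

omit [Group G] [TopologicalSpace G] [IsTopologicalGroup G] [LocallyCompactSpace G] [BorelSpace G]
   [μ.IsHaarMeasure] [μ.Regular] in
theorem const_mem_Linf (c : ℝ) : (fun _ => c : G → ℝ) ∈ Linf μ := memLp_top_const c

omit [Group G] [IsTopologicalGroup G] [LocallyCompactSpace G] [μ.IsHaarMeasure] [μ.Regular] in
theorem mem_Linf_of_continuous {f : G → ℝ} (hf : Continuous f) {C : ℝ} (hC : ∀ x, |f x| ≤ C) :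
    f ∈ Linf μ :=
  memLp_top_of_bound hf.aestronglyMeasurable C (Filter.Eventually.of_forall hC)

omit [μ.Regular] in
theorem exists_smoothing_one_eq_one :
    ∃ φ : C_c(G, ℝ), (∀ x, 0 ≤ φ x) ∧ ∀ x, smoothing μ φ (fun _ => 1) x = 1 := by
  obtain ⟨⟨f, hf⟩, hfs, hf0, hf1⟩ : ∃ f : C(G, ℝ), HasCompactSupport f ∧ 0 ≤ f ∧ f 1 ≠ 0 :=
    exists_continuous_nonneg_pos 1
  have hpos : 0 < ∫ y, smoothingKernel f y ∂μ :=
    (continuous_smoothingKernel hf).integral_pos_of_hasCompactSupport_nonneg_nonzero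
      (hasCompactSupport_smoothingKernel hfs)
      (fun y => mul_nonneg (hf0 _) (NNReal.coe_nonneg _)) (x := 1) (by
        simp only [smoothingKernel, inv_one, modularCharacterFun_map_one, NNReal.coe_one, mul_one]
        exact hf1)
  refine ⟨(∫ y, smoothingKernel f y ∂μ)⁻¹ • ⟨⟨f, hf⟩, hfs⟩, fun x =>
    mul_nonneg (inv_nonneg.2 hpos.le) (hf0 x), fun x => ?_⟩
  rw [smoothing_smul_left]
  simp only [smoothing, mul_one]
  exact inv_mul_cancel₀ hpos.ne'

/-- The smoothing of a function, as an element of the space of left uniformly continuous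
functions. -/
noncomputable def smoothingCblu (φ : C_c(G, ℝ)) : Linf μ →ₗ[ℝ] Cblu G where
  toFun f := ⟨smoothing μ φ f, smoothing_mem_Cblu φ f.2⟩
  map_add' f k := Subtype.ext (funext fun x => smoothing_add_right φ f.2 k.2 x)
  map_smul' c f := Subtype.ext (funext fun x => smoothing_smul_right φ c f x)

theorem smoothingCblu_apply (φ : C_c(G, ℝ)) (f : Linf μ) (x : G) :
    (smoothingCblu φ f : G → ℝ) x = smoothing μ φ f x := rfl

/-- The mean of a smoothing depends on the smoothing function only through its integral. -/
theorem exists_mean_smoothing_eq [T2Space G] {m : Cblu G →ₗ[ℝ] ℝ}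
    (hm : IsLeftInvariantMean (Cblu G) m) (f : Linf μ) :
    ∃ c : ℝ, ∀ φ : C_c(G, ℝ), m (smoothingCblu φ f) = c * ∫ x, φ x ∂μ := by
  have key : ∀ f : Linf μ, (∀ᵐ y ∂μ, 0 ≤ (f : G → ℝ) y) →
      ∃ c : ℝ, ∀ φ : C_c(G, ℝ), m (smoothingCblu φ f) = c * ∫ x, φ x ∂μ := fun f hf => by
    refine exists_eq_mul_integral_of_translateLeft
      { toFun := fun φ => m (smoothingCblu φ f)
        map_add' := fun φ ψ => ?_
        map_smul' := fun c φ => ?_ } (fun φ hφ => hm.nonneg _ (smoothing_nonneg hφ hf))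
        fun φ g => ?_
    · rw [← map_add]
      exact congrArg m (Subtype.ext (funext fun x => smoothing_add_left φ ψ f.2 x))
    · rw [RingHom.id_apply, ← map_smul]
      exact congrArg m (Subtype.ext (funext fun x => smoothing_smul_left c φ f x))
    · refine hm.left_inv g⁻¹ _ _ fun x => ?_
      rw [inv_inv]
      exact (smoothing_mul_left φ f g x).symm
  obtain ⟨C, hC0, hC⟩ := exists_ae_bound_of_mem_Linf f.2
  -- The Riesz representation needs a positive functional, so f is written as (f + C) - C with both
  -- terms nonnegative almost everywhere.
  let k : Linf μ := ⟨fun _ => C, const_mem_Linf C⟩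
  obtain ⟨c, hc⟩ := key (f + k) (hC.mono fun y hy => by
    change 0 ≤ (f : G → ℝ) y + C
    linarith [neg_le_of_abs_le hy])
  obtain ⟨d, hd⟩ := key k (Filter.Eventually.of_forall fun _ => hC0)
  refine ⟨c - d, fun φ => ?_⟩
  rw [sub_mul, ← hc, ← hd, map_add, map_add, add_sub_cancel_right]

/-- A left-invariant mean on the left uniformly continuous functions extends to a left-invariant
mean on `L_∞`, which is also right-invariant if the given one is. -/
theorem exists_mean_Linf [T2Space G] (μ : Measure G) [μ.IsHaarMeasure] [μ.Regular]
    {m : Cblu G →ₗ[ℝ] ℝ} (hm : IsLeftInvariantMean (Cblu G) m) :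
    ∃ n : Linf μ →ₗ[ℝ] ℝ, (∀ f : Linf μ, (∀ h, (f : G → ℝ) h = 1) → n f = 1) ∧
      (∀ f : Linf μ, (∀ᵐ h ∂μ, 0 ≤ (f : G → ℝ) h) → 0 ≤ n f) ∧
      (∀ (g : G) (f f' : Linf μ), (∀ h, (f' : G → ℝ) h = (f : G → ℝ) (g⁻¹ * h)) → n f' = n f) ∧
      ((∀ (g : G) (f f' : Cblu G),
        (∀ h, (f' : G → ℝ) h = (f : G → ℝ) (h * g⁻¹)) → m f' = m f) →
        ∀ (g : G) (f f' : Linf μ),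
          (∀ h, (f' : G → ℝ) h = (f : G → ℝ) (h * g⁻¹)) → n f' = n f) := by
  obtain ⟨φ, hφ0, hφ1⟩ := exists_smoothing_one_eq_one (μ := μ)
  refine ⟨m.comp (smoothingCblu φ), fun f hf => hm.map_one _ fun x => ?_,
    fun f hf => hm.nonneg _ (smoothing_nonneg hφ0 hf), fun g f f' h => ?_,
    fun hr g f f' h => hr g _ _ fun x => ?_⟩
  · rw [smoothingCblu_apply, ← hφ1 x, funext hf]
  · obtain ⟨c, hc⟩ := exists_mean_smoothing_eq hm f
    -- Translating f on the left amounts to replacing φ by `ψ`; the factor Δ(g) makes their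
    -- integrals equal, so the means agree.
    let ψ : C_c(G, ℝ) := (modularCharacterFun g : ℝ) • translateRight φ g⁻¹
    have h1 : smoothingCblu φ f' = smoothingCblu ψ f := Subtype.ext (funext fun x => by
      rw [smoothingCblu_apply, smoothingCblu_apply, funext h, smoothing_comp_mul_left]
      rfl)
    have h2 : ∫ x, ψ x ∂μ = ∫ x, φ x ∂μ := by
      change ∫ x, (modularCharacterFun g : ℝ) * φ (x * g⁻¹) ∂μ = _
      rw [integral_const_mul, integral_mul_right_eq_modularCharacterFun_mul, ← mul_assoc,
        ← NNReal.coe_mul, ← modularCharacterFun_map_mul, mul_inv_cancel,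
        modularCharacterFun_map_one, NNReal.coe_one, one_mul]
    change m (smoothingCblu φ f') = m (smoothingCblu φ f)
    rw [h1, hc, hc, h2]
  · rw [smoothingCblu_apply, smoothingCblu_apply, funext h, smoothing_comp_mul_right]

/-- Inversion of a left uniformly continuous function need not stay in that class, but it stays
bounded and continuous. So the given mean is first extended to L_∞, composed with inversion there to
be right-invariant, combined with the original mean, and the resulting bi-invariant mean is extended
again. -/
theorem exists_isBiInvariantMean_Linf [T2Space G] (μ : Measure G) [μ.IsHaarMeasure] [μ.Regular]
    (hA : IsAmenable G) :
    ∃ m : Linf μ →ₗ[ℝ] ℝ, IsBiInvariantMean (ae μ) (Linf μ) m := by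
  obtain ⟨m, hm⟩ := hA
  obtain ⟨n, hn1, hn0, hnl, -⟩ := exists_mean_Linf μ hm
  have hinv : ∀ f : Cblu G, (fun h => (f : G → ℝ) h⁻¹) ∈ Linf μ := fun f => by
    obtain ⟨C, hC⟩ := f.2.1
    exact mem_Linf_of_continuous ((continuous_of_mem_Cblu f.2).comp continuous_inv) fun x => hC _
  obtain ⟨p, hp, hpr⟩ := exists_biInvariant_mean_Cblu (m' :=
    { toFun := fun f => n ⟨_, hinv f⟩
      map_add' := fun f k => by rw [← map_add]; rfl
      map_smul' := fun c f => by rw [RingHom.id_apply, ← map_smul]; rfl }) hm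
    ⟨fun f hf => hn1 _ fun _ => hf _,
      fun f hf => hn0 _ (Filter.Eventually.of_forall fun _ => hf _)⟩
    (fun g f f' h => hnl g⁻¹ _ _ fun k => by
      change (f' : G → ℝ) k⁻¹ = (f : G → ℝ) (g⁻¹⁻¹ * k)⁻¹
      rw [h, mul_inv_rev, inv_inv])
  obtain ⟨q, hq1, hq0, hql, hqr⟩ := exists_mean_Linf μ hp
  exact ⟨q, hq1, hq0, hql, hqr hpr⟩

end Smoothing

end LocallyCompact

/-! ### The two admissible domains treated together -/

variable {G : Type u} [Group G] [TopologicalSpace G] [IsTopologicalGroup G] [T2Space G]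
  [MeasurableSpace G] [BorelSpace G] {l : Filter G} {D : Submodule ℝ (G → ℝ)}

theorem IsMeanDomain.exists_isBiInvariantMean (hD : IsMeanDomain l D) (hA : IsAmenable G) :
    ∃ m : D →ₗ[ℝ] ℝ, IsBiInvariantMean l D m := by
  obtain ⟨hlc, μ, hμ, hr, rfl, rfl⟩ | ⟨hS, rfl, rfl⟩ := hD
  · exact exists_isBiInvariantMean_Linf μ hA
  · exact hS.exists_isBiInvariantMean hA

-- The averaging construction needs of the domain only this inclusion; in the SIN case it rests on
-- the coincidence of the two uniform continuities.
omit [T2Space G] in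
theorem IsMeanDomain.Cbru_le (hD : IsMeanDomain l D) : Cbru G ≤ D := by
  obtain ⟨hlc, μ, hμ, hr, rfl, rfl⟩ | ⟨hS, rfl, rfl⟩ := hD
  · intro f hf
    obtain ⟨C, hC⟩ := hf.1
    exact mem_Linf_of_continuous (continuous_of_mem_Cbru hf) hC
  · rw [hS.Cbu_eq]
    exact hS.Cbru_le_Cblu

omit [T2Space G] in
theorem exists_isMeanDomain (hG : LocallyCompactSpace G ∨ IsSIN G) :
    ∃ (l : Filter G) (D : Submodule ℝ (G → ℝ)), IsMeanDomain l D := by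
  obtain hlc | hS := hG
  · exact ⟨_, _, Or.inl ⟨hlc, Measure.haar, inferInstance, inferInstance, rfl, rfl⟩⟩
  · exact ⟨_, _, Or.inr ⟨hS, rfl, rfl⟩⟩

theorem IsBiInvariantMean.isMean {G : Type u} [Group G] {l : Filter G} {D : Submodule ℝ (G → ℝ)}
    {m : D →ₗ[ℝ] ℝ} (hm : IsBiInvariantMean l D m) : IsMean D m :=
  ⟨hm.map_one, fun f hf => hm.nonneg f (Filter.Eventually.of_forall hf)⟩

end LipFree

theorem mainTheorem1 {G : Type*} [Group G] [TopologicalSpace G] [IsTopologicalGroup G] [T2Space G]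
    [MeasurableSpace G] [BorelSpace G]
    {M : Type*} [MetricSpace M] [MulAction G M] [IsIsometricSMul G M] [ContinuousSMul G M] (o : M)
    (hbdd : ∀ x : M, Bornology.IsBounded (MulAction.orbit G x))
    (hA : LipFree.IsAmenable G) (hG : LocallyCompactSpace G ∨ LipFree.IsSIN G) :
    -- bi-invariant means exist, and for each of them the averaging operator is as described
    (∀ (l : Filter G) (D : Submodule ℝ (G → ℝ)), LipFree.IsMeanDomain l D →
      (∃ m : D →ₗ[ℝ] ℝ, LipFree.IsBiInvariantMean l D m) ∧
      ∀ m : D →ₗ[ℝ] ℝ, LipFree.IsBiInvariantMean l D m →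
        ∃ R : LipFree.FreeSpace o →L[ℝ] StrongDual ℝ (StrongDual ℝ (LipFree.FreeSpace o)),
          (∀ (x : LipFree.FreeSpace o) (φ : StrongDual ℝ (LipFree.FreeSpace o)),
            ∃ h : (fun g : G => φ (LipFree.linearAct o g x)) ∈ D, R x φ = m ⟨_, h⟩) ∧
          ‖R‖ ≤ 1 ∧
          IsClosed (Set.range R) ∧
          Nonempty (R.range ≃ₗᵢ[ℝ] LipFree.FreeSpace (LipFree.OrbitClosures.mk G o)) ∧
          IsIdempotentElem (LipFree.dualProjection R) ∧
          Set.range (LipFree.dualProjection R) =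
            LipFree.dualEquiv o '' (LipFree.invariantLip G o : Set (LipFree.Lip0 o)) ∧
          R.ker = (Submodule.span ℝ
            {z | ∃ (x : M) (g : G), z = LipFree.δ o (g • x) - LipFree.δ o x}).topologicalClosure) ∧
    -- `Lip₀(M/G)` is isometric to a 1-complemented subspace of `Lip₀(M)`
    (∃ (J : LipFree.Lip0 (LipFree.OrbitClosures.mk G o) →ₗᵢ[ℝ] LipFree.Lip0 o)
        (P : LipFree.Lip0 o →L[ℝ] LipFree.Lip0 o),
      IsIdempotentElem P ∧ ‖P‖ ≤ 1 ∧ Set.range P = Set.range J) ∧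
    -- `I_G` is 1-complemented in `F(M)` when `Lip₀^G(M) ∩ (I_G)^⊥ = {0}`
    (LipFree.invariantLip G o ⊓
        LipFree.annihilator (LipFree.invariantVectors G o : Set (LipFree.FreeSpace o)) = ⊥ →
      ∃ P : LipFree.FreeSpace o →L[ℝ] LipFree.FreeSpace o,
        IsIdempotentElem P ∧ ‖P‖ ≤ 1 ∧
          Set.range P = (LipFree.invariantVectors G o : Set (LipFree.FreeSpace o))) := by
  refine ⟨fun l D hD => ⟨hD.exists_isBiInvariantMean hA, fun m hm => ?_⟩, ?_⟩
  · have hle := hD.Cbru_le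
    have hn := LipFree.norm_averagingOp_eq o hbdd hm.right_inv hle hm.isMean
    exact ⟨LipFree.averagingOp o hle hm.isMean,
      fun x φ => ⟨_, LipFree.averagingOp_apply o hle hm.isMean x φ⟩,
      LipFree.norm_averagingOp_le o hle hm.isMean,
      LipFree.isClosed_range_of_norm_eq _ _ hn,
      LipFree.nonempty_range_isometry _ _ _ hn (LipFree.norm_freeQuotient_eq o)
        (LipFree.denseRange_freeQuotient o),
      LipFree.isIdempotentElem_dualProjection_averagingOp o hbdd hm.right_inv hle hm.isMean,
      LipFree.range_dualProjection_averagingOp o hbdd hm.right_inv hle hm.isMean,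
      LipFree.ker_eq_of_norm_eq (LipFree.orbitDifferences G o) _ hn⟩
  · obtain ⟨l, D, hD⟩ := LipFree.exists_isMeanDomain hG
    obtain ⟨m, hm⟩ := hD.exists_isBiInvariantMean hA
    exact ⟨LipFree.exists_projection_lip o hbdd hm.right_inv hD.Cbru_le hm.isMean,
      LipFree.exists_projection_invariantVectors o hbdd hm.right_inv hD.Cbru_le hm.isMean⟩
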